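/- Let $b\ge 3$ be an integer, let $R$ be a complete collection of residues modulo $b$ consisting of nonnegative integers, and let $D\subset R$ with $0\in D$ and $2\le |D|<b$. Let $\mathcal K=\bigl\{\sum_{j=0}^{k} d_j b^j : k\in\mathbb N,\ d_j\in D\bigr\}$ be the corresponding integer Cantor set, and let $0=k_1<k_2<\cdots$ be its elements written in increasing order. Let $(X,\mathcal A,\mu)$ be a probability space, and let $T\colon X\to X$ be an invertible measure preserving transformation (with measurable inverse) that is weakly mixing, that is, $\lim_{N\to\infty}\frac1N\sum_{n=1}^N|\mu(A\cap T^{-n}B)-\mu(A)\mu(B)|=0$ for all $A,B\in\mathcal A$. Then, for all $t$ and all complex-valued functions $f_1,\dots,f_t\in L^\infty(X)$, $$\lim_{N\to\infty}\frac1N\sum_{n=1}^N\prod_{s=1}^t T^{s k_n}f_s=\prod_{s=1}^t\int_X f_s\,d\mu ,$$ where $T^m f=f\circ T^m$, and the limit holds in the norm of $L^2(X)$. -/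

import Mathlib

open MeasureTheory Filter Topology
open scoped ENNReal

/-- `(X, μ, T)` is a weakly mixing (invertible) measure preserving system: `T` preserves `μ`, and
for all measurable `A`, `B` the averages over `n ∈ {1, …, N}` of `|μ(A ∩ T⁻ⁿ B) - μ(A) μ(B)|`
tend to `0` as `N → ∞`. -/
structure IsWeaklyMixing {X : Type*} [MeasurableSpace X] (μ : Measure X) (T : X ≃ᵐ X) :
    Prop where
  measurePreserving : MeasurePreserving T μ μ
  tendsto_average : ∀ A B : Set X, MeasurableSet A → MeasurableSet B →
    Tendsto (fun N : ℕ => (N : ℝ)⁻¹ *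
      ∑ n ∈ Finset.Icc 1 N, |μ.real (A ∩ T^[n] ⁻¹' B) - μ.real A * μ.real B|) atTop (𝓝 0)

/-- `D` is an admissible set of digits in base `b` for a classical integer Cantor set: `b ≥ 3`,
`2 ≤ |D| < b`, and `D` is contained in some complete collection `R` of residues modulo `b`.
Digits are nonnegative: with a negative digit (and the digit `0`) the Cantor set is unbounded
below, and cannot be written as an increasing sequence. -/
structure IsClassicalDigitSet (b : ℕ) (D : Finset ℕ) : Prop where
  three_le_base : 3 ≤ b
  two_le_card : 2 ≤ D.card
  card_lt_base : D.card < b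
  subset_residues : ∃ R : Finset ℕ,
    Set.BijOn (fun r : ℕ => (r : ZMod b)) (R : Set ℕ) Set.univ ∧ D ⊆ R

/-- The integer Cantor set of all sums `∑_{j=0}^k d_j b^j`, with `k ∈ ℕ` and digits `d_j ∈ D`. -/
def integerCantorSet (b : ℕ) (D : Finset ℕ) : Set ℕ :=
  {m | ∃ (k : ℕ) (d : ℕ → ℕ), (∀ j, d j ∈ D) ∧ m = ∑ j ∈ Finset.range (k + 1), d j * b ^ j}

/-- The increasing enumeration of the integer Cantor set, with indices starting at `0`:
`cantorSeq b D n` is the element usually denoted `k_{n+1}`, where `k_1 < k_2 < ⋯`. -/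
noncomputable def cantorSeq (b : ℕ) (D : Finset ℕ) (n : ℕ) : ℕ :=
  Nat.nth (fun m => m ∈ integerCantorSet b D) n

/-- The set being enumerated is infinite, so `cantorSeq` takes no default values. -/
theorem integerCantorSet_infinite {b : ℕ} {D : Finset ℕ} (h : IsClassicalDigitSet b D)
    (h0 : 0 ∈ D) : (integerCantorSet b D).Infinite := by
  obtain ⟨d, hd, hd0⟩ := Finset.exists_mem_ne h.two_le_card 0
  have hb := h.three_le_base
  refine Set.infinite_of_injective_forall_mem (f := fun k : ℕ => d * b ^ k) ?_ ?_
  · intro i j hij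
    exact Nat.pow_right_injective (by omega : 2 ≤ b)
      (Nat.eq_of_mul_eq_mul_left (Nat.pos_of_ne_zero hd0) hij)
  · intro k
    refine ⟨k, fun j => if j = k then d else 0, fun j => ?_, ?_⟩
    · dsimp only
      split_ifs <;> assumption
    · simp

/-- The multiple ergodic average
`x ↦ (1/N) ∑_{n=1}^N ∏_{s=1}^t f_s (T^{s k_n} x)` along the integer Cantor set with base `b` and
digits `D`. The index `s : Fin t` stands for the number `s + 1`. -/
noncomputable def cantorAverage {X : Type*} [MeasurableSpace X] (b : ℕ) (D : Finset ℕ)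
    (T : X ≃ᵐ X) {t : ℕ} (f : Fin t → X → ℂ) (N : ℕ) (x : X) : ℂ :=
  (N : ℂ)⁻¹ * ∑ n ∈ Finset.range N,
    ∏ s : Fin t, f s (T^[((s : ℕ) + 1) * cantorSeq b D n] x)

/-! Let `K` be the integer Cantor set and `B_m` its block of `m`-digit sums. Digits are distinct mod
`b` and `0 ∈ D`, so `K` is the disjoint union of the translates `b^m y + B_m`, `y ∈ K`. Averages
along `K` can therefore be taken block by block up to a boundary error, and Cauchy–Schwarz gives a
van der Corput criterion (`tendsto_average_cantorInitial_zero`): a bounded sequence `u` has averages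
tending to `0` as soon as its block sums are small in mean square over `y`.

For `u k = ∏ T^{a_s k} f_s`, expanding the square produces inner products at `z + b^m y` and `w +
b^m y`. Invariance of `μ` removes the smallest exponent, so induction on the number of functions,
for all increasing positive exponents, turns the `y`-average into `∏ s, ⟨T^{a_s z} f_s, T^{a_s w}
f_s⟩`. Splitting each function into a constant and a mean-zero part, one may assume that some `f_r`
has mean zero. It then suffices that `|⟨T^{az} f, T^{aw} f⟩|` is small on average over `z, w ∈ B_m`.

With `V = U ⊗ U` and `F = f ⊗ f̄`, this is a mean ergodic theorem along blocks
(`tendsto_average_cantorBlock_zero`). The block average is a product of commuting contractions, one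
per digit position, so its norm on `F` decreases to a limit. A small drop at level `m` forces near
invariance under `V^(a d b^m)` for a nonzero digit `d`. Full base-`b` averages with these steps can
then be inserted at small cost. Their product is an ordinary ergodic average along a progression,
which weak mixing sends to `0`; hence the limit is `0`. -/

/-! ### Blocks of digit sums -/

/-- The set of all sums `∑_{j<m} d_j b^j` with digits `d_j ∈ D`. -/
def cantorBlock (b : ℕ) (D : Finset ℕ) : ℕ → Finset ℕ
  | 0 => {0}
  | m + 1 => (cantorBlock b D m ×ˢ D).image fun p => p.1 + b ^ m * p.2

namespace IsClassicalDigitSet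

variable {b : ℕ} {D : Finset ℕ}

theorem eq_of_modEq (h : IsClassicalDigitSet b D) {d e : ℕ} (hd : d ∈ D) (he : e ∈ D)
    (hde : d ≡ e [MOD b]) : d = e := by
  obtain ⟨R, hR, hDR⟩ := h.subset_residues
  exact hR.injOn (hDR hd) (hDR he) ((ZMod.natCast_eq_natCast_iff d e b).2 hde)

theorem base_pos (h : IsClassicalDigitSet b D) : 0 < b := by
  have := h.three_le_base
  omega

theorem card_pos (h : IsClassicalDigitSet b D) : 0 < D.card := by
  have := h.two_le_card
  omega

/-- Digits may exceed `b`, so ordinary uniqueness of base-`b` expansions is unavailable;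
distinctness of the digits mod `b` replaces it. Reduction mod `b^m` identifies the lower digits, and
cancelling `b^m` identifies the top one. -/
theorem eq_of_mem_cantorBlock_of_modEq (h : IsClassicalDigitSet b D) {m : ℕ} :
    ∀ {z w : ℕ}, z ∈ cantorBlock b D m → w ∈ cantorBlock b D m → z ≡ w [MOD b ^ m] → z = w := by
  induction m with
  | zero => simp +contextual [cantorBlock]
  | succ m ih =>
    intro z w hz hw hzw
    simp only [cantorBlock, Finset.mem_image, Finset.mem_product, Prod.exists] at hz hw
    obtain ⟨z, d, ⟨hz, hd⟩, rfl⟩ := hz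
    obtain ⟨w, e, ⟨hw, he⟩, rfl⟩ := hw
    have hzw' : z = w := by
      refine ih hz hw ?_
      have := Nat.ModEq.of_mul_right b (pow_succ b m ▸ hzw)
      simpa [Nat.ModEq] using this
    subst hzw'
    have h1 := Nat.ModEq.add_left_cancel' z hzw
    rw [pow_succ] at h1
    have h2 := Nat.ModEq.mul_left_cancel' (pow_pos h.base_pos m).ne' h1
    rw [h.eq_of_modEq hd he h2]

theorem add_pow_mul_injOn (h : IsClassicalDigitSet b D) (m : ℕ) (Y : Finset ℕ) :
    Set.InjOn (fun p : ℕ × ℕ => p.1 + b ^ m * p.2) (cantorBlock b D m ×ˢ Y : Finset (ℕ × ℕ)) := by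
  rintro ⟨z, y⟩ hz ⟨w, y'⟩ hw hzw
  simp only [Finset.coe_product, Set.mem_prod, Finset.mem_coe] at hz hw hzw
  have hzw' : z = w := by
    refine h.eq_of_mem_cantorBlock_of_modEq hz.1 hw.1 ?_
    have : z + b ^ m * y ≡ w + b ^ m * y' [MOD b ^ m] := by rw [hzw]
    simpa [Nat.ModEq] using this
  subst hzw'
  have := Nat.eq_of_mul_eq_mul_left (pow_pos h.base_pos m) (Nat.add_left_cancel hzw)
  rw [this]

theorem sum_cantorBlock_succ (h : IsClassicalDigitSet b D) {E : Type*} [AddCommMonoid E] (m : ℕ)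
    (u : ℕ → E) : ∑ z ∈ cantorBlock b D (m + 1), u z =
      ∑ z ∈ cantorBlock b D m, ∑ d ∈ D, u (z + b ^ m * d) := by
  rw [cantorBlock, Finset.sum_image (h.add_pow_mul_injOn m D), Finset.sum_product]

theorem card_cantorBlock (h : IsClassicalDigitSet b D) (m : ℕ) :
    (cantorBlock b D m).card = D.card ^ m := by
  induction m with
  | zero => simp [cantorBlock]
  | succ m ih =>
    rw [cantorBlock, Finset.card_image_of_injOn (h.add_pow_mul_injOn m D), Finset.card_product, ih,
      pow_succ]

theorem le_of_mem_cantorBlock (h : IsClassicalDigitSet b D) (m : ℕ) :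
    ∀ z ∈ cantorBlock b D m, z ≤ b ^ m * D.sup id := by
  induction m with
  | zero => simp [cantorBlock]
  | succ m ih =>
    intro z hz
    simp only [cantorBlock, Finset.mem_image, Finset.mem_product, Prod.exists] at hz
    obtain ⟨z, d, ⟨hz, hd⟩, rfl⟩ := hz
    have h1 := ih z hz
    have h2 : d ≤ D.sup id := Finset.le_sup (f := id) hd
    have h3 := h.three_le_base
    calc z + b ^ m * d ≤ b ^ m * D.sup id + b ^ m * D.sup id := by gcongr
      _ = b ^ m * D.sup id * 2 := by ring
      _ ≤ b ^ m * D.sup id * b := by gcongr; omega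
      _ = b ^ (m + 1) * D.sup id := by ring

end IsClassicalDigitSet

/-! ### Self-similarity of the Cantor set -/

section Decomposition

variable {b : ℕ} {D : Finset ℕ}

theorem mem_cantorBlock_iff (m z : ℕ) : z ∈ cantorBlock b D m ↔
    ∃ d : ℕ → ℕ, (∀ j < m, d j ∈ D) ∧ z = ∑ j ∈ Finset.range m, d j * b ^ j := by
  induction m generalizing z with
  | zero => simp [cantorBlock]
  | succ m ih =>
    simp only [cantorBlock, Finset.mem_image, Finset.mem_product, Prod.exists]
    constructor
    · rintro ⟨z, e, ⟨hz, he⟩, rfl⟩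
      obtain ⟨d, hd, rfl⟩ := (ih z).1 hz
      refine ⟨Function.update d m e, fun j hj => ?_, ?_⟩
      · rcases eq_or_ne j m with rfl | hjm
        · simpa using he
        · simpa [hjm] using hd j (by omega)
      · rw [Finset.sum_range_succ, Function.update_self, mul_comm e]
        congr 1
        refine Finset.sum_congr rfl fun j hj => ?_
        rw [Function.update_of_ne (Finset.mem_range.1 hj).ne]
    · rintro ⟨d, hd, rfl⟩
      refine ⟨_, d m, ⟨(ih _).2 ⟨d, fun j hj => hd j (by omega), rfl⟩, hd m (by omega)⟩, ?_⟩
      rw [Finset.sum_range_succ, mul_comm (d m)]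

theorem mem_integerCantorSet_iff (h0 : 0 ∈ D) (k : ℕ) :
    k ∈ integerCantorSet b D ↔ ∃ m, k ∈ cantorBlock b D m := by
  constructor
  · rintro ⟨m, d, hd, rfl⟩
    exact ⟨m + 1, (mem_cantorBlock_iff _ _).2 ⟨d, fun j _ => hd j, rfl⟩⟩
  · rintro ⟨m, hm⟩
    obtain ⟨d, hd, rfl⟩ := (mem_cantorBlock_iff _ _).1 hm
    refine ⟨m, fun j => if j < m then d j else 0, fun j => ?_, ?_⟩
    · dsimp only
      split_ifs with hj
      exacts [hd j hj, h0]
    · rw [Finset.sum_range_succ]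
      simp only [lt_irrefl, if_false, zero_mul, add_zero]
      exact Finset.sum_congr rfl fun j hj => by rw [if_pos (Finset.mem_range.1 hj)]

theorem add_pow_mul_mem_cantorBlock (m l z y : ℕ) (hz : z ∈ cantorBlock b D m)
    (hy : y ∈ cantorBlock b D l) : z + b ^ m * y ∈ cantorBlock b D (m + l) := by
  obtain ⟨d, hd, rfl⟩ := (mem_cantorBlock_iff _ _).1 hz
  obtain ⟨e, he, rfl⟩ := (mem_cantorBlock_iff _ _).1 hy
  refine (mem_cantorBlock_iff _ _).2 ⟨fun j => if j < m then d j else e (j - m), fun j hj => ?_, ?_⟩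
  · dsimp only
    split_ifs with hjm
    exacts [hd j hjm, he _ (by omega)]
  · rw [Finset.sum_range_add, Finset.mul_sum]
    congr 1
    · refine Finset.sum_congr rfl fun j hj => ?_
      dsimp only
      rw [if_pos (Finset.mem_range.1 hj)]
    · refine Finset.sum_congr rfl fun j _ => ?_
      dsimp only
      rw [if_neg (by omega), Nat.add_sub_cancel_left, pow_add]
      ring

theorem add_pow_mul_mem_integerCantorSet (h0 : 0 ∈ D) {m z y : ℕ} (hz : z ∈ cantorBlock b D m)
    (hy : y ∈ integerCantorSet b D) : z + b ^ m * y ∈ integerCantorSet b D := by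
  obtain ⟨l, hl⟩ := (mem_integerCantorSet_iff h0 y).1 hy
  exact (mem_integerCantorSet_iff h0 _).2 ⟨m + l, add_pow_mul_mem_cantorBlock m l z y hz hl⟩

theorem exists_eq_add_pow_mul (h0 : 0 ∈ D) (m : ℕ) {k : ℕ} (hk : k ∈ integerCantorSet b D) :
    ∃ z ∈ cantorBlock b D m, ∃ y ∈ integerCantorSet b D, k = z + b ^ m * y := by
  obtain ⟨l, d, hd, rfl⟩ := hk
  -- Padding with the digit `0` makes at least `m` digits available, so that the first `m` can be
  -- split off.
  set e : ℕ → ℕ := fun j => if j < l + 1 then d j else 0 with he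
  have heD : ∀ j, e j ∈ D := fun j => by
    rw [he]
    dsimp only
    split_ifs
    exacts [hd j, h0]
  have hsum : ∑ j ∈ Finset.range (l + 1), d j * b ^ j =
      ∑ j ∈ Finset.range (m + (l + 1)), e j * b ^ j := by
    rw [add_comm m, Finset.sum_range_add _ (l + 1) m,
      Finset.sum_eq_zero (s := Finset.range m), add_zero]
    · exact Finset.sum_congr rfl fun j hj => by rw [he]; simp only [if_pos (Finset.mem_range.1 hj)]
    · intro j _
      rw [he]
      simp only [if_neg (show ¬ l + 1 + j < l + 1 by omega), zero_mul]
  refine ⟨_, (mem_cantorBlock_iff m _).2 ⟨e, fun j _ => heD j, rfl⟩, _,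
    ⟨l, fun j => e (m + j), fun j => heD _, rfl⟩, ?_⟩
  rw [hsum, Finset.sum_range_add, Finset.mul_sum]
  congr 1
  refine Finset.sum_congr rfl fun j _ => ?_
  rw [pow_add]
  ring

end Decomposition

/-! ### Initial segments and the van der Corput criterion -/

open scoped Classical in
/-- The elements of the integer Cantor set that are less than `x`. -/
noncomputable def cantorInitial (b : ℕ) (D : Finset ℕ) (x : ℕ) : Finset ℕ :=
  (Finset.range x).filter fun k => k ∈ integerCantorSet b D

section Initial

variable {b : ℕ} {D : Finset ℕ}

theorem mem_cantorInitial {x k : ℕ} :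
    k ∈ cantorInitial b D x ↔ k < x ∧ k ∈ integerCantorSet b D := by
  simp [cantorInitial]

theorem tendsto_card_cantorInitial (h : IsClassicalDigitSet b D) (h0 : 0 ∈ D) :
    Tendsto (fun x => (cantorInitial b D x).card) atTop atTop := by
  refine tendsto_atTop_atTop_of_monotone (fun x y hxy => ?_) fun n => ?_
  · refine Finset.card_le_card fun k => ?_
    simp only [mem_cantorInitial]
    exact fun hk => ⟨hk.1.trans_le hxy, hk.2⟩
  · obtain ⟨s, hs, hsn⟩ := (integerCantorSet_infinite h h0).exists_subset_card_eq n
    refine ⟨s.sup id + 1, hsn ▸ Finset.card_le_card fun k hk => ?_⟩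
    exact mem_cantorInitial.2 ⟨Nat.lt_succ_of_le (Finset.le_sup (f := id) hk), hs hk⟩

theorem sum_range_cantorSeq (h : IsClassicalDigitSet b D) (h0 : 0 ∈ D) {E : Type*}
    [AddCommMonoid E] (u : ℕ → E) (N : ℕ) : ∑ n ∈ Finset.range N, u (cantorSeq b D n) =
      ∑ k ∈ cantorInitial b D (cantorSeq b D N), u k := by
  have hmono : StrictMono (cantorSeq b D) := Nat.nth_strictMono (integerCantorSet_infinite h h0)
  have himage : cantorInitial b D (cantorSeq b D N) =
      (Finset.range N).image (cantorSeq b D) := by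
    ext k
    simp only [mem_cantorInitial, Finset.mem_image, Finset.mem_range]
    constructor
    · rintro ⟨hkN, hk⟩
      have hk' := Set.ext_iff.1 (Nat.range_nth_of_infinite (integerCantorSet_infinite h h0)) k
      obtain ⟨n, rfl⟩ := hk'.2 hk
      exact ⟨n, hmono.lt_iff_lt.1 hkN, rfl⟩
    · rintro ⟨n, hn, rfl⟩
      exact ⟨hmono hn, Nat.nth_mem_of_infinite (integerCantorSet_infinite h h0) n⟩
  rw [himage, Finset.sum_image hmono.injective.injOn]

theorem tendsto_cantorSeq (h : IsClassicalDigitSet b D) (h0 : 0 ∈ D) :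
    Tendsto (cantorSeq b D) atTop atTop :=
  (Nat.nth_strictMono (integerCantorSet_infinite h h0)).tendsto_atTop

theorem card_cantorInitial_cantorSeq (h : IsClassicalDigitSet b D) (h0 : 0 ∈ D) (N : ℕ) :
    (cantorInitial b D (cantorSeq b D N)).card = N := by
  have := sum_range_cantorSeq h h0 (fun _ => 1) N
  simpa using this.symm

/-- With digits beyond `b` the blocks can overlap in order, so the cutoff `x` need not fall between
two blocks. A block element is at most `b^m * D.sup id`, so only the last `D.sup id + 1` values of
`y` can contribute elements `≥ x`. -/
theorem norm_sum_cantorInitial_sub_le (h : IsClassicalDigitSet b D) (h0 : 0 ∈ D) {E : Type*}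
    [NormedAddCommGroup E] {u : ℕ → E} {B : ℝ} (hu : ∀ k, ‖u k‖ ≤ B) (m x : ℕ) :
    ‖∑ y ∈ cantorInitial b D (x ⌈/⌉ b ^ m), ∑ z ∈ cantorBlock b D m, u (z + b ^ m * y) -
      ∑ k ∈ cantorInitial b D x, u k‖ ≤ (D.sup id + 1 : ℕ) * (D.card : ℝ) ^ m * B := by
  classical
  have hB : 0 ≤ B := (norm_nonneg _).trans (hu 0)
  have hbm : 0 < b ^ m := pow_pos h.base_pos m
  set Y := x ⌈/⌉ b ^ m with hY
  have hYle : ∀ y, Y ≤ y ↔ x ≤ b ^ m * y := fun y => by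
    rw [hY, ceilDiv_le_iff_le_mul hbm]
  set f : ℕ × ℕ → ℕ := fun p => p.1 + b ^ m * p.2 with hf
  set full := (cantorBlock b D m ×ˢ cantorInitial b D Y).image f with hfull
  have hsub : cantorInitial b D x ⊆ full := by
    intro k hk
    rw [mem_cantorInitial] at hk
    obtain ⟨z, hz, y, hy, rfl⟩ := exists_eq_add_pow_mul h0 m hk.2
    refine Finset.mem_image.2 ⟨(z, y), Finset.mem_product.2 ⟨hz, mem_cantorInitial.2 ⟨?_, hy⟩⟩, rfl⟩
    by_contra! hle
    have := (hYle y).1 hle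
    omega
  have hsum : ∑ k ∈ full, u k =
      ∑ y ∈ cantorInitial b D Y, ∑ z ∈ cantorBlock b D m, u (z + b ^ m * y) := by
    rw [hfull, Finset.sum_image (h.add_pow_mul_injOn m _), Finset.sum_product_right]
  have hdiff : full \ cantorInitial b D x ⊆
      (cantorBlock b D m ×ˢ Finset.Ico (Y - (D.sup id + 1)) Y).image f := by
    intro k hk
    rw [Finset.mem_sdiff] at hk
    obtain ⟨⟨z, y⟩, hzy, rfl⟩ := Finset.mem_image.1 hk.1
    obtain ⟨hz, hy⟩ := Finset.mem_product.1 hzy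
    rw [mem_cantorInitial] at hy
    refine Finset.mem_image_of_mem f (Finset.mem_product.2 ⟨hz, Finset.mem_Ico.2 ⟨?_, hy.1⟩⟩)
    have hx : x ≤ z + b ^ m * y := by
      by_contra! hlt
      exact hk.2 (mem_cantorInitial.2 ⟨hlt, add_pow_mul_mem_integerCantorSet h0 hz hy.2⟩)
    have h1 := h.le_of_mem_cantorBlock m z hz
    have h2 : Y ≤ D.sup id + y := (hYle _).2 (by rw [mul_add]; omega)
    dsimp only
    omega
  have hcard : (full \ cantorInitial b D x).card ≤ (D.sup id + 1) * D.card ^ m := by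
    refine (Finset.card_le_card hdiff).trans (Finset.card_image_le.trans ?_)
    rw [Finset.card_product, h.card_cantorBlock, Nat.card_Ico, mul_comm]
    gcongr
    omega
  rw [← hsum, ← Finset.sum_sdiff hsub, add_sub_cancel_right]
  calc ‖∑ k ∈ full \ cantorInitial b D x, u k‖ ≤ ((full \ cantorInitial b D x).card : ℝ) * B := by
        rw [← nsmul_eq_mul]
        exact (norm_sum_le _ _).trans (Finset.sum_le_card_nsmul _ _ _ fun k _ => hu k)
    _ ≤ (D.sup id + 1 : ℕ) * (D.card : ℝ) ^ m * B := by
        gcongr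
        exact_mod_cast hcard

/-- A van der Corput type criterion along integer Cantor sets. -/
theorem tendsto_average_cantorInitial_zero (h : IsClassicalDigitSet b D) (h0 : 0 ∈ D) {E : Type*}
    [NormedAddCommGroup E] [NormedSpace ℂ E] {u : ℕ → E} {B : ℝ} (hu : ∀ k, ‖u k‖ ≤ B)
    (hcor : ∀ ε > (0 : ℝ), ∃ m, ∀ᶠ x in atTop,
      ∑ y ∈ cantorInitial b D x, ‖∑ z ∈ cantorBlock b D m, u (z + b ^ m * y)‖ ^ 2 ≤
        ε * ((D.card : ℝ) ^ m) ^ 2 * (cantorInitial b D x).card) :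
    Tendsto (fun x => ((cantorInitial b D x).card : ℂ)⁻¹ • ∑ k ∈ cantorInitial b D x, u k)
      atTop (𝓝 0) := by
  have hB : 0 ≤ B := (norm_nonneg _).trans (hu 0)
  rw [NormedAddGroup.tendsto_nhds_zero]
  intro ε hε
  obtain ⟨m, hm⟩ := hcor ((ε / 4) ^ 2) (by positivity)
  set L : ℝ := ((D.sup id + 1 : ℕ) : ℝ) with hL
  set Q : ℝ := (D.card : ℝ) ^ m with hQ
  have hQpos : 0 < Q := pow_pos (by exact_mod_cast h.card_pos) m
  have hbm : 0 < b ^ m := pow_pos h.base_pos m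
  have hY : Tendsto (fun x : ℕ => x ⌈/⌉ b ^ m) atTop atTop := by
    refine tendsto_atTop.2 fun n => ?_
    filter_upwards [eventually_ge_atTop (b ^ m * n)] with x hx
    have := (ceilDiv_le_iff_le_mul hbm (b := x) (c := x ⌈/⌉ b ^ m)).1 le_rfl
    exact Nat.le_of_mul_le_mul_left (hx.trans this) hbm
  have hn := tendsto_natCast_atTop_atTop (R := ℝ) |>.comp
    ((tendsto_card_cantorInitial h h0).comp hY)
  -- The threshold gives `ε/4 * n + L * B ≤ ε/2 * (n - L)`: boundary terms are absorbed in both the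
  -- sum and the cardinality.
  filter_upwards [hY.eventually hm, hn.eventually_gt_atTop (2 * L + 4 * L * B / ε)] with x hx hxn
  set n : ℝ := ((cantorInitial b D (x ⌈/⌉ b ^ m)).card : ℝ) with hndef
  replace hxn : 2 * L + 4 * L * B / ε < n := hxn
  have hLpos : 0 < L := by rw [hL]; positivity
  have hnpos : 0 < n := lt_of_le_of_lt (by positivity) hxn
  have h1 := norm_sum_cantorInitial_sub_le h h0 hu m x
  -- The constant sequence `1` compares cardinalities, bounding the denominator below by `(n - L) *
  -- Q`.
  have h2 := norm_sum_cantorInitial_sub_le h h0 (u := fun _ => (1 : ℝ)) (B := 1) (by simp) m x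
  simp only [Finset.sum_const, nsmul_eq_mul, mul_one, h.card_cantorBlock, Nat.cast_pow,
    Real.norm_eq_abs] at h2
  have h3 := (abs_le.1 h2).2
  rw [← hL, ← hQ, ← hndef] at h3
  rw [← hL, ← hQ] at h1
  have hcs : ‖∑ y ∈ cantorInitial b D (x ⌈/⌉ b ^ m), ∑ z ∈ cantorBlock b D m,
      u (z + b ^ m * y)‖ ≤ ε / 4 * Q * n := by
    refine (norm_sum_le _ _).trans ((le_abs_self _).trans (abs_le_of_sq_le_sq ?_ (by positivity)))
    refine (sq_sum_le_card_mul_sum_sq).trans ?_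
    calc n * _ ≤ n * ((ε / 4) ^ 2 * Q ^ 2 * n) := by gcongr
      _ = (ε / 4 * Q * n) ^ 2 := by ring
  have h4 : ‖∑ k ∈ cantorInitial b D x, u k‖ ≤ ε / 4 * Q * n + L * Q * B := by
    have := norm_sub_norm_le (∑ k ∈ cantorInitial b D x, u k)
      (∑ y ∈ cantorInitial b D (x ⌈/⌉ b ^ m), ∑ z ∈ cantorBlock b D m, u (z + b ^ m * y))
    rw [norm_sub_rev] at this
    linarith
  have h5 : (n - L) * Q ≤ (cantorInitial b D x).card := by linarith
  have h6 : L * B ≤ ε / 4 * n - ε / 2 * L := by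
    have : ε / 4 * (2 * L + 4 * L * B / ε) < ε / 4 * n := by gcongr
    have h7 : ε / 4 * (2 * L + 4 * L * B / ε) = ε / 2 * L + L * B := by
      field_simp
      ring
    linarith
  have hnL : 0 < n - L := by
    have : 0 ≤ 4 * L * B / ε := by positivity
    linarith
  have h8 : 0 < (n - L) * Q := mul_pos hnL hQpos
  rw [norm_smul, norm_inv, Complex.norm_natCast, inv_mul_lt_iff₀ (h8.trans_le h5)]
  calc ‖∑ k ∈ cantorInitial b D x, u k‖ ≤ ε / 4 * Q * n + L * Q * B := h4
    _ = (ε / 4 * n + L * B) * Q := by ring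
    _ ≤ (ε / 4 * n + (ε / 4 * n - ε / 2 * L)) * Q := by gcongr
    _ = ((n - L) * Q) * (ε / 2) := by ring
    _ < ((n - L) * Q) * ε := by gcongr; linarith
    _ ≤ (cantorInitial b D x).card * ε := by gcongr

end Initial

/-! ### A mean ergodic theorem along blocks for an isometry -/

section Isometry

open Polynomial

variable {E : Type*} [NormedAddCommGroup E] [InnerProductSpace ℂ E]

theorem sum_sum_norm_sub_sq {ι : Type*} (s : Finset ι) (v : ι → E) :
    ∑ i ∈ s, ∑ j ∈ s, ‖v i - v j‖ ^ 2 =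
      2 * (s.card * ∑ i ∈ s, ‖v i‖ ^ 2 - ‖∑ i ∈ s, v i‖ ^ 2) := by
  have h1 : ‖∑ i ∈ s, v i‖ ^ 2 = ∑ i ∈ s, ∑ j ∈ s, RCLike.re (inner ℂ (v i) (v j)) := by
    rw [← inner_self_eq_norm_sq (𝕜 := ℂ), sum_inner, map_sum]
    simp_rw [inner_sum, map_sum]
  simp_rw [h1, norm_sub_sq (𝕜 := ℂ), Finset.sum_add_distrib, Finset.sum_sub_distrib,
    ← Finset.mul_sum]
  simp only [Finset.sum_const, nsmul_eq_mul, ← Finset.mul_sum]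
  ring

/-- A variance identity: averaging vectors of equal norm loses norm exactly as far as they differ
from each other. It converts norm drops into near invariance and back. -/
theorem norm_sq_sub_norm_average_sq {ι : Type*} {s : Finset ι} (hs : s.Nonempty) (v : ι → E)
    {r : ℝ} (hv : ∀ i ∈ s, ‖v i‖ = r) :
    r ^ 2 - ‖(s.card : ℂ)⁻¹ • ∑ i ∈ s, v i‖ ^ 2 =
      (2 * (s.card : ℝ) ^ 2)⁻¹ * ∑ i ∈ s, ∑ j ∈ s, ‖v i - v j‖ ^ 2 := by
  have hcard : (s.card : ℝ) ≠ 0 := by exact_mod_cast hs.card_ne_zero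
  have hsum : ∑ i ∈ s, ‖v i‖ ^ 2 = s.card * r ^ 2 := by
    rw [Finset.sum_congr rfl fun i hi => by rw [hv i hi], Finset.sum_const, nsmul_eq_mul]
  rw [sum_sum_norm_sub_sq, hsum, norm_smul, norm_inv, Complex.norm_natCast]
  field_simp

variable (V : E →ₗᵢ[ℂ] E)

theorem LinearIsometry.norm_linearMap_pow_apply (n : ℕ) (v : E) :
    ‖(V.toLinearMap ^ n) v‖ = ‖v‖ := by
  induction n with
  | zero => simp
  | succ n ih => rw [pow_succ', Module.End.mul_apply, LinearIsometry.coe_toLinearMap, V.norm_map, ih]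

theorem LinearIsometry.norm_pow_mul_sub_le (e i : ℕ) (v : E) :
    ‖(V.toLinearMap ^ (e * i)) v - v‖ ≤ i * ‖(V.toLinearMap ^ e) v - v‖ := by
  induction i with
  | zero => simp
  | succ i ih =>
    have : (V.toLinearMap ^ (e * (i + 1))) v - v =
        (V.toLinearMap ^ (e * i)) ((V.toLinearMap ^ e) v - v) +
          ((V.toLinearMap ^ (e * i)) v - v) := by
      rw [map_sub, ← Module.End.mul_apply, ← pow_add, mul_add, mul_one]
      abel
    rw [this]
    refine (norm_add_le _ _).trans ?_
    rw [V.norm_linearMap_pow_apply]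
    push_cast
    linarith

/-- The polynomial whose value at an operator is the average of its powers with exponents `c d`,
`d ∈ D`. -/
noncomputable def averagePoly (D : Finset ℕ) (c : ℕ) : ℂ[X] :=
  C (D.card : ℂ)⁻¹ * ∑ d ∈ D, X ^ (c * d)

theorem aeval_averagePoly (D : Finset ℕ) (c : ℕ) (v : E) :
    aeval V.toLinearMap (averagePoly D c) v =
      (D.card : ℂ)⁻¹ • ∑ d ∈ D, (V.toLinearMap ^ (c * d)) v := by
  simp [averagePoly, LinearMap.sum_apply, Algebra.algebraMap_eq_smul_one]

/-- Polynomials whose value at `V` is a contraction. -/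
def IsContractionPoly (p : ℂ[X]) : Prop :=
  ∀ v, ‖aeval V.toLinearMap p v‖ ≤ ‖v‖

variable {V}

theorem IsContractionPoly.mul {p r : ℂ[X]} (hp : IsContractionPoly V p)
    (hr : IsContractionPoly V r) : IsContractionPoly V (p * r) := fun v => by
  rw [map_mul, Module.End.mul_apply]
  exact (hp _).trans (hr v)

theorem IsContractionPoly.prod {ι : Type*} (s : Finset ι) {p : ι → ℂ[X]}
    (hp : ∀ i ∈ s, IsContractionPoly V (p i)) : IsContractionPoly V (∏ i ∈ s, p i) :=
  Finset.prod_induction p _ (fun _ _ => IsContractionPoly.mul) (fun v => by simp) hp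

variable (V)

theorem norm_sq_sub_norm_averagePoly_sq {D : Finset ℕ} (hD : D.Nonempty) (c : ℕ) (v : E) :
    ‖v‖ ^ 2 - ‖aeval V.toLinearMap (averagePoly D c) v‖ ^ 2 = (2 * (D.card : ℝ) ^ 2)⁻¹ *
      ∑ d ∈ D, ∑ e ∈ D, ‖(V.toLinearMap ^ (c * d)) v - (V.toLinearMap ^ (c * e)) v‖ ^ 2 := by
  rw [aeval_averagePoly]
  exact norm_sq_sub_norm_average_sq hD _ fun d _ => V.norm_linearMap_pow_apply _ v

theorem isContractionPoly_averagePoly {D : Finset ℕ} (hD : D.Nonempty) (c : ℕ) :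
    IsContractionPoly V (averagePoly D c) := fun v => by
  have h1 := norm_sq_sub_norm_averagePoly_sq V hD c v
  have h2 : 0 ≤ ‖v‖ ^ 2 - ‖aeval V.toLinearMap (averagePoly D c) v‖ ^ 2 := by
    rw [h1]
    positivity
  exact (le_abs_self _).trans (abs_le_of_sq_le_sq (by linarith) (norm_nonneg _))

theorem norm_pow_sub_sq_le {D : Finset ℕ} (h0 : 0 ∈ D) {d : ℕ} (hd : d ∈ D) (c : ℕ) (v : E) :
    ‖(V.toLinearMap ^ (c * d)) v - v‖ ^ 2 ≤
      2 * (D.card : ℝ) ^ 2 * (‖v‖ ^ 2 - ‖aeval V.toLinearMap (averagePoly D c) v‖ ^ 2) := by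
  have hcard : (D.card : ℝ) ≠ 0 := by exact_mod_cast (Finset.card_pos.2 ⟨0, h0⟩).ne'
  rw [norm_sq_sub_norm_averagePoly_sq V ⟨0, h0⟩ c v, mul_inv_cancel_left₀ (by positivity)]
  calc ‖(V.toLinearMap ^ (c * d)) v - v‖ ^ 2
      = ‖(V.toLinearMap ^ (c * d)) v - (V.toLinearMap ^ (c * 0)) v‖ ^ 2 := by simp
    _ ≤ ∑ e ∈ D, ‖(V.toLinearMap ^ (c * d)) v - (V.toLinearMap ^ (c * e)) v‖ ^ 2 :=
        Finset.single_le_sum (f := fun e => ‖(V.toLinearMap ^ (c * d)) v -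
          (V.toLinearMap ^ (c * e)) v‖ ^ 2) (fun _ _ => by positivity) h0
    _ ≤ _ := Finset.single_le_sum (f := fun d => ∑ e ∈ D, ‖(V.toLinearMap ^ (c * d)) v -
          (V.toLinearMap ^ (c * e)) v‖ ^ 2) (fun _ _ => by positivity) hd

/-- The converse direction to `norm_pow_sub_sq_le`: if `V^c` almost fixes `v`, so do `V^(c i)` for
`i < b`, and averaging them loses little norm. -/
theorem norm_sq_sub_norm_averagePoly_range_sq_le {b : ℕ} (hb : 0 < b) (c : ℕ) (v : E) :
    ‖v‖ ^ 2 - ‖aeval V.toLinearMap (averagePoly (Finset.range b) c) v‖ ^ 2 ≤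
      2 * (b : ℝ) ^ 2 * ‖(V.toLinearMap ^ c) v - v‖ ^ 2 := by
  have hb' : (0 : ℝ) < b := by exact_mod_cast hb
  rw [norm_sq_sub_norm_averagePoly_sq V (Finset.nonempty_range_iff.2 hb.ne') c v,
    Finset.card_range, inv_mul_le_iff₀ (by positivity)]
  have key : ∀ i ∈ Finset.range b, ∀ j ∈ Finset.range b,
      ‖(V.toLinearMap ^ (c * i)) v - (V.toLinearMap ^ (c * j)) v‖ ^ 2 ≤
        (2 * b * ‖(V.toLinearMap ^ c) v - v‖) ^ 2 := by
    intro i hi j hj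
    have hi' : (i : ℝ) ≤ b := by exact_mod_cast (Finset.mem_range.1 hi).le
    have hj' : (j : ℝ) ≤ b := by exact_mod_cast (Finset.mem_range.1 hj).le
    gcongr
    rw [← sub_sub_sub_cancel_right _ _ v]
    refine (norm_sub_le _ _).trans ?_
    refine (add_le_add (V.norm_pow_mul_sub_le c i v) (V.norm_pow_mul_sub_le c j v)).trans ?_
    rw [← add_mul]
    gcongr
    linarith
  refine (Finset.sum_le_sum fun i hi => Finset.sum_le_sum fun j hj => key i hi j hj).trans ?_
  simp only [Finset.sum_const, nsmul_eq_mul, Finset.card_range]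
  apply le_of_eq
  ring

/-- Base-`b` expansion with all digits: each `i < b^n` arises exactly once. -/
theorem prod_averagePoly_range {b : ℕ} (e n : ℕ) :
    ∏ j ∈ Finset.range n, averagePoly (Finset.range b) (e * b ^ j) =
      averagePoly (Finset.range (b ^ n)) e := by
  induction n with
  | zero => simp [averagePoly]
  | succ n ih =>
    have hsum : ∀ c k : ℕ, ∑ i ∈ Finset.range (k * c), (X : ℂ[X]) ^ (e * i) =
        (∑ i ∈ Finset.range k, X ^ (e * i)) * ∑ i ∈ Finset.range c, X ^ (e * k * i) := by
      intro c k
      induction c with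
      | zero => simp
      | succ c ihc =>
        rw [mul_add, mul_one, Finset.sum_range_add, ihc, Finset.sum_range_succ, mul_add]
        congr 1
        rw [Finset.sum_mul]
        refine Finset.sum_congr rfl fun i _ => ?_
        rw [← pow_add]
        ring_nf
    rw [Finset.prod_range_succ, ih]
    simp only [averagePoly, Finset.card_range]
    rw [pow_succ, hsum]
    push_cast
    rw [mul_inv, map_mul]
    ring

variable {b : ℕ} {D : Finset ℕ}

theorem prod_averagePoly_eq (h : IsClassicalDigitSet b D) (a m : ℕ) :
    ∏ j ∈ Finset.range m, averagePoly D (a * b ^ j) =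
      C ((D.card : ℂ) ^ m)⁻¹ * ∑ z ∈ cantorBlock b D m, X ^ (a * z) := by
  induction m with
  | zero => simp [cantorBlock]
  | succ m ih =>
    rw [Finset.prod_range_succ, ih, h.sum_cantorBlock_succ]
    simp_rw [mul_add, pow_add, ← Finset.mul_sum, ← Finset.sum_mul]
    rw [averagePoly, pow_one, mul_inv, map_mul]
    simp_rw [mul_assoc]
    ring

/-- Mean ergodic theorem along the blocks of an integer Cantor set. -/
theorem tendsto_average_cantorBlock_zero (h : IsClassicalDigitSet b D) (h0 : 0 ∈ D) {F : E}
    (hF : ∀ k : ℕ, 0 < k → Tendsto (fun N : ℕ => (N : ℂ)⁻¹ •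
      ∑ n ∈ Finset.range N, (V.toLinearMap ^ (k * n)) F) atTop (𝓝 0)) {a : ℕ} (ha : 0 < a) :
    Tendsto (fun m : ℕ => ((D.card : ℂ) ^ m)⁻¹ •
      ∑ z ∈ cantorBlock b D m, (V.toLinearMap ^ (a * z)) F) atTop (𝓝 0) := by
  obtain ⟨d, hd, hd0⟩ := Finset.exists_mem_ne h.two_le_card 0
  have hDne : D.Nonempty := ⟨0, h0⟩
  have hb := h.base_pos
  have hrne : (Finset.range b).Nonempty := Finset.nonempty_range_iff.2 hb.ne'
  set P : ℕ → ℂ[X] := fun j => averagePoly D (a * b ^ j) with hP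
  set Q : ℕ → ℂ[X] := fun m => ∏ j ∈ Finset.range m, P j with hQ
  -- `R M n` averages along the progression `a * d * b^M * i`, `i < b^n`. All operators are
  -- polynomials in `V`, so they commute.
  set R : ℕ → ℕ → ℂ[X] := fun M n =>
    ∏ j ∈ Finset.range n, averagePoly (Finset.range b) (a * d * b ^ M * b ^ j) with hR
  set s : ℕ → ℝ := fun m => ‖aeval V.toLinearMap (Q m) F‖ ^ 2 with hs
  have hPc : ∀ j, IsContractionPoly V (P j) := fun j => isContractionPoly_averagePoly V hDne _
  have hQc : ∀ m, IsContractionPoly V (Q m) := fun m => .prod _ fun j _ => hPc j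
  have hRc : ∀ M n, IsContractionPoly V (R M n) := fun M n =>
    .prod _ fun j _ => isContractionPoly_averagePoly V hrne _
  have hstep : ∀ m, ‖(V.toLinearMap ^ (a * d * b ^ m)) (aeval V.toLinearMap (Q m) F) -
      aeval V.toLinearMap (Q m) F‖ ^ 2 ≤ 2 * (D.card : ℝ) ^ 2 * (s m - s (m + 1)) := by
    intro m
    have := norm_pow_sub_sq_le V h0 hd (a * b ^ m) (aeval V.toLinearMap (Q m) F)
    rw [← Module.End.mul_apply (aeval V.toLinearMap (averagePoly D (a * b ^ m))), ← map_mul,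
      mul_comm (averagePoly D (a * b ^ m))] at this
    rw [show a * d * b ^ m = a * b ^ m * d by ring]
    simpa only [hs, hQ, hP, Finset.prod_range_succ] using this
  have hdiff : ∀ M m n, M + m ≤ n →
      ‖aeval V.toLinearMap (R M m * Q n) F‖ ^ 2 - ‖aeval V.toLinearMap (R M (m + 1) * Q n) F‖ ^ 2 ≤
        4 * (b : ℝ) ^ 2 * (D.card : ℝ) ^ 2 * (s (M + m) - s (M + m + 1)) := by
    intro M m n hmn
    have h1 := norm_sq_sub_norm_averagePoly_range_sq_le V hb (a * d * b ^ (M + m))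
      (aeval V.toLinearMap (R M m * Q n) F)
    rw [← Module.End.mul_apply (aeval V.toLinearMap (averagePoly _ _)), ← map_mul,
      ← mul_assoc, mul_comm (averagePoly (Finset.range b) _)] at h1
    have h2 : R M m * averagePoly (Finset.range b) (a * d * b ^ (M + m)) = R M (m + 1) := by
      simp only [hR, Finset.prod_range_succ, pow_add, mul_assoc]
    rw [h2] at h1
    have h3 : ‖(V.toLinearMap ^ (a * d * b ^ (M + m))) (aeval V.toLinearMap (R M m * Q n) F) -
        aeval V.toLinearMap (R M m * Q n) F‖ ^ 2 ≤
        2 * (D.card : ℝ) ^ 2 * (s (M + m) - s (M + m + 1)) := by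
      refine le_trans ?_ (hstep (M + m))
      -- `Q (M + m)` is a factor of `Q n`, and the remaining factors are contractions, so the near
      -- invariance of `Q (M + m)` applied to `F` is inherited.
      have hfac : R M m * Q n = (R M m * ∏ j ∈ Finset.Ico (M + m) n, P j) * Q (M + m) := by
        rw [mul_assoc, mul_comm (∏ j ∈ Finset.Ico (M + m) n, P j)]
        simp only [hQ]
        rw [Finset.prod_range_mul_prod_Ico _ hmn]
      have hcon : IsContractionPoly V (R M m * ∏ j ∈ Finset.Ico (M + m) n, P j) :=
        (hRc M m).mul (.prod _ fun j _ => hPc j)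
      rw [hfac]
      generalize R M m * ∏ j ∈ Finset.Ico (M + m) n, P j = W at hcon
      have hcomm : (V.toLinearMap ^ (a * d * b ^ (M + m))) (aeval V.toLinearMap (W * Q (M + m)) F) -
          aeval V.toLinearMap (W * Q (M + m)) F = aeval V.toLinearMap W
            ((V.toLinearMap ^ (a * d * b ^ (M + m))) (aeval V.toLinearMap (Q (M + m)) F) -
              aeval V.toLinearMap (Q (M + m)) F) := by
        have hX : V.toLinearMap ^ (a * d * b ^ (M + m)) =
          aeval V.toLinearMap ((X : ℂ[X]) ^ (a * d * b ^ (M + m))) := by simp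
        rw [hX, map_sub, ← Module.End.mul_apply, ← Module.End.mul_apply, ← Module.End.mul_apply,
          ← Module.End.mul_apply, ← map_mul, ← map_mul, ← map_mul, ← map_mul, mul_left_comm,
          mul_assoc W]
      rw [hcomm]
      gcongr
      exact hcon _
    calc _ ≤ _ := h1
      _ ≤ 2 * (b : ℝ) ^ 2 * (2 * (D.card : ℝ) ^ 2 * (s (M + m) - s (M + m + 1))) := by gcongr
      _ = _ := by ring
  set K : ℝ := 4 * (b : ℝ) ^ 2 * (D.card : ℝ) ^ 2 with hK
  -- The costs of inserting the factors of `R M n` one at a time telescope.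
  have hmain : ∀ M n, s (M + n) ≤ ‖aeval V.toLinearMap (R M n) F‖ ^ 2 + K * (s M - s (M + n)) := by
    intro M n
    have h1 := Finset.sum_le_sum fun m (hm : m ∈ Finset.range n) =>
      hdiff M m (M + n) (by have := Finset.mem_range.1 hm; omega)
    rw [Finset.sum_range_sub', ← Finset.mul_sum] at h1
    have h2 := Finset.sum_range_sub' (fun m => s (M + m)) n
    simp only [← add_assoc, add_zero] at h2
    rw [h2] at h1
    have h3 : R M 0 = 1 := by simp [hR]
    rw [h3, one_mul, mul_comm (R M n), map_mul, Module.End.mul_apply] at h1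
    have h4 := hQc (M + n) (aeval V.toLinearMap (R M n) F)
    have h5 : ‖aeval V.toLinearMap (Q (M + n)) (aeval V.toLinearMap (R M n) F)‖ ^ 2 ≤
      ‖aeval V.toLinearMap (R M n) F‖ ^ 2 := by gcongr
    have h6 : s (M + n) = ‖aeval V.toLinearMap (Q (M + n)) F‖ ^ 2 := rfl
    linarith
  have hanti : Antitone s := antitone_nat_of_succ_le fun m => by
    have : Q (m + 1) = P m * Q m := by simp only [hQ, Finset.prod_range_succ, mul_comm]
    simp only [hs]
    rw [this, map_mul, Module.End.mul_apply]
    gcongr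
    exact hPc m _
  obtain ⟨l, hl⟩ : ∃ l, Tendsto s atTop (𝓝 l) :=
    ⟨_, tendsto_atTop_ciInf hanti ⟨0, by rintro _ ⟨m, rfl⟩; positivity⟩⟩
  have hle : ∀ M, l ≤ K * (s M - l) := by
    intro M
    have h1 : Tendsto (fun n => s (M + n)) atTop (𝓝 l) := by
      simpa only [add_comm M] using (tendsto_add_atTop_iff_nat M).2 hl
    have h2 : Tendsto (fun n => ‖aeval V.toLinearMap (R M n) F‖ ^ 2) atTop (𝓝 0) := by
      -- `R M n` is the ordinary average with step `a * d * b^M`, along the subsequence `N = b^n`.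
      have h3 := (hF (a * d * b ^ M) (by positivity)).comp
        (tendsto_pow_atTop_atTop_of_one_lt (by have := h.three_le_base; omega : 1 < b))
      have h4 := h3.norm.pow 2
      simp only [norm_zero, ne_eq, OfNat.ofNat_ne_zero, not_false_eq_true, zero_pow] at h4
      refine h4.congr fun n => ?_
      simp only [hR, prod_averagePoly_range, aeval_averagePoly, Finset.card_range,
        Function.comp_apply]
    have h5 := le_of_tendsto_of_tendsto' h1 (h2.add ((h1.const_sub (s M)).const_mul K)) (hmain M)
    simpa using h5
  have hl0 : l ≤ 0 := by
    have h1 : Tendsto (fun M => K * (s M - l)) atTop (𝓝 (K * (l - l))) :=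
      (hl.sub_const l).const_mul K
    rw [sub_self, mul_zero] at h1
    exact ge_of_tendsto' h1 hle
  have hl0' : l = 0 := le_antisymm hl0 (ge_of_tendsto' hl fun m => by positivity)
  rw [hl0'] at hl
  rw [tendsto_zero_iff_norm_tendsto_zero]
  have h1 := hl.sqrt
  rw [Real.sqrt_zero] at h1
  refine h1.congr fun m => ?_
  simp only [hs, hQ, hP, Real.sqrt_sq (norm_nonneg _), prod_averagePoly_eq h]
  simp [LinearMap.sum_apply, Algebra.algebraMap_eq_smul_one]

end Isometry

/-! ### Bounded measurable functions and the Koopman operator -/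

section Bounded

variable {X : Type*} [MeasurableSpace X]

/-- The bounded measurable complex-valued functions. -/
def boundedMeasurable (X : Type*) [MeasurableSpace X] : StarSubalgebra ℂ (X → ℂ) where
  carrier := {g | Measurable g ∧ ∃ C : ℝ, ∀ x, ‖g x‖ ≤ C}
  mul_mem' := by
    rintro f g ⟨hf, C, hC⟩ ⟨hg, K, hK⟩
    refine ⟨hf.mul hg, C * K, fun x => ?_⟩
    rw [Pi.mul_apply, norm_mul]
    exact mul_le_mul (hC x) (hK x) (norm_nonneg _) ((norm_nonneg _).trans (hC x))
  add_mem' := by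
    rintro f g ⟨hf, C, hC⟩ ⟨hg, K, hK⟩
    exact ⟨hf.add hg, C + K, fun x => (norm_add_le _ _).trans (add_le_add (hC x) (hK x))⟩
  algebraMap_mem' c := ⟨measurable_const, ‖c‖, fun _ => le_rfl⟩
  star_mem' := by
    rintro f ⟨hf, C, hC⟩
    exact ⟨Complex.continuous_conj.measurable.comp hf, C, fun x => by rw [Pi.star_apply, norm_star]; exact hC x⟩

variable (μ : Measure X) [IsProbabilityMeasure μ]

namespace boundedMeasurable

theorem memLp (g : boundedMeasurable X) (p : ℝ≥0∞) : MemLp (g : X → ℂ) p μ :=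
  .of_bound g.2.1.aestronglyMeasurable g.2.2.choose (ae_of_all _ g.2.2.choose_spec)

theorem integrable (g : boundedMeasurable X) : Integrable (g : X → ℂ) μ :=
  memLp_one_iff_integrable.1 (memLp μ g 1)

/-- The class of a bounded measurable function in `L²`. -/
noncomputable def toLp : boundedMeasurable X →ₗ[ℂ] Lp ℂ 2 μ where
  toFun g := (memLp μ g 2).toLp (g : X → ℂ)
  map_add' _ _ := rfl
  map_smul' _ _ := rfl

/-- The integral of a bounded measurable function. -/
noncomputable def mean : boundedMeasurable X →ₗ[ℂ] ℂ where
  toFun g := ∫ x, (g : X → ℂ) x ∂μ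
  map_add' f g := integral_add (integrable μ f) (integrable μ g)
  map_smul' c _ := integral_const_mul c _

theorem inner_toLp (f g : boundedMeasurable X) :
    inner ℂ (toLp μ f) (toLp μ g) = mean μ (star f * g) := by
  rw [L2.inner_def]
  refine integral_congr_ae ?_
  filter_upwards [(memLp μ f 2).coeFn_toLp, (memLp μ g 2).coeFn_toLp] with x hf hg
  change inner ℂ ((memLp μ f 2).toLp (f : X → ℂ) x) ((memLp μ g 2).toLp (g : X → ℂ) x) = _
  rw [hf, hg]
  simp [mul_comm]

theorem mean_star (g : boundedMeasurable X) : mean μ (star g) = star (mean μ g) :=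
  integral_conj

theorem mean_one : mean μ (1 : boundedMeasurable X) = 1 := by
  simp [mean]

theorem norm_mean_le {g : boundedMeasurable X} {C : ℝ} (h : ∀ x, ‖(g : X → ℂ) x‖ ≤ C) :
    ‖mean μ g‖ ≤ C := by
  change ‖∫ x, (g : X → ℂ) x ∂μ‖ ≤ C
  simpa using norm_integral_le_of_norm_le_const (μ := μ) (ae_of_all _ h)

theorem norm_toLp_le {g : boundedMeasurable X} {C : ℝ} (hC : 0 ≤ C)
    (h : ∀ x, ‖(g : X → ℂ) x‖ ≤ C) : ‖toLp μ g‖ ≤ C := by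
  have h1 : measureUnivNNReal μ = 1 := by simp [measureUnivNNReal]
  simpa [h1] using Lp.norm_le_of_ae_bound (p := 2) (f := toLp μ g) hC (by
    filter_upwards [(memLp μ g 2).coeFn_toLp] with x hx
    change ‖(memLp μ g 2).toLp (g : X → ℂ) x‖ ≤ C
    rw [hx]
    exact h x)

variable {T : X ≃ᵐ X}

/-- The operator `g ↦ g ∘ T^n` on bounded measurable functions. -/
def koopman (T : X ≃ᵐ X) (n : ℕ) : boundedMeasurable X →⋆ₐ[ℂ] boundedMeasurable X where
  toFun g := ⟨fun x => (g : X → ℂ) (T^[n] x), g.2.1.comp (T.measurable.iterate n),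
    g.2.2.imp fun _ hC _ => hC _⟩
  map_one' := rfl
  map_mul' _ _ := rfl
  map_zero' := rfl
  map_add' _ _ := rfl
  commutes' _ := rfl
  map_star' _ := rfl

theorem koopman_apply (n : ℕ) (g : boundedMeasurable X) (x : X) :
    (koopman T n g : X → ℂ) x = (g : X → ℂ) (T^[n] x) := rfl

theorem koopman_koopman (m n : ℕ) (g : boundedMeasurable X) :
    koopman T m (koopman T n g) = koopman T (m + n) g := by
  ext x
  simp only [koopman_apply, ← Function.iterate_add_apply, add_comm m]

variable {μ}

theorem mean_koopman (hT : MeasurePreserving T μ μ) (n : ℕ) (g : boundedMeasurable X) :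
    mean μ (koopman T n g) = mean μ g := by
  have h := hT.iterate n
  have := integral_map (μ := μ) (f := (g : X → ℂ)) h.measurable.aemeasurable
    g.2.1.aestronglyMeasurable
  rw [h.map_eq] at this
  exact this.symm

theorem compMeasurePreserving_pow_toLp (hT : MeasurePreserving T μ μ) (n : ℕ)
    (g : boundedMeasurable X) :
    ((Lp.compMeasurePreservingₗᵢ ℂ T hT : Lp ℂ 2 μ →ₗᵢ[ℂ] Lp ℂ 2 μ).toLinearMap ^ n) (toLp μ g) =
      toLp μ (koopman T n g) := by
  induction n generalizing g with
  | zero => rfl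
  | succ n ih =>
    rw [pow_succ, Module.End.mul_apply]
    have : (Lp.compMeasurePreservingₗᵢ ℂ T hT : Lp ℂ 2 μ →ₗᵢ[ℂ] Lp ℂ 2 μ).toLinearMap (toLp μ g) =
      toLp μ (koopman T 1 g) := rfl
    rw [this, ih, koopman_koopman]

end boundedMeasurable

end Bounded

/-! ### Strong Cesàro convergence -/

section Averages

/-- The averages of the absolute values of the sequence tend to zero. -/
def StronglyCesaroNull (w : ℕ → ℂ) : Prop :=
  Tendsto (fun N : ℕ => (N : ℝ)⁻¹ * ∑ n ∈ Finset.range N, ‖w n‖) atTop (𝓝 0)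

namespace StronglyCesaroNull

theorem of_le {w : ℕ → ℂ} {v : ℕ → ℝ}
    (hv : Tendsto (fun N : ℕ => (N : ℝ)⁻¹ * ∑ n ∈ Finset.range N, v n) atTop (𝓝 0))
    (h : ∀ n, ‖w n‖ ≤ v n) : StronglyCesaroNull w :=
  squeeze_zero (fun N => by positivity) (fun N => by gcongr; exact h _) hv

theorem add {v w : ℕ → ℂ} (hv : StronglyCesaroNull v) (hw : StronglyCesaroNull w) :
    StronglyCesaroNull (fun n => v n + w n) := by
  refine of_le (v := fun n => ‖v n‖ + ‖w n‖) ?_ fun n => norm_add_le _ _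
  simpa [Finset.sum_add_distrib, mul_add] using Tendsto.add hv hw

theorem const_mul {w : ℕ → ℂ} (hw : StronglyCesaroNull w) (c : ℂ) :
    StronglyCesaroNull (fun n => c * w n) := by
  refine of_le (v := fun n => ‖c‖ * ‖w n‖) ?_ fun n => (norm_mul _ _).le
  simpa [← Finset.mul_sum, mul_left_comm] using Tendsto.const_mul ‖c‖ hw

theorem of_approx {w : ℕ → ℂ}
    (h : ∀ ε > (0 : ℝ), ∃ v, StronglyCesaroNull v ∧ ∀ n, ‖w n - v n‖ ≤ ε) :
    StronglyCesaroNull w := by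
  refine NormedAddGroup.tendsto_nhds_zero.2 fun ε hε => ?_
  obtain ⟨v, hv, hwv⟩ := h (ε / 2) (half_pos hε)
  filter_upwards [NormedAddGroup.tendsto_nhds_zero.1 hv (ε / 2) (half_pos hε),
    eventually_gt_atTop 0] with N hN hN0
  have hN0' : (0 : ℝ) < N := by exact_mod_cast hN0
  rw [Real.norm_of_nonneg (by positivity)] at hN ⊢
  have h1 : ∑ n ∈ Finset.range N, ‖w n‖ ≤ ∑ n ∈ Finset.range N, (ε / 2 + ‖v n‖) := by
    gcongr with n
    linarith [norm_sub_norm_le (w n) (v n), hwv n]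
  rw [Finset.sum_add_distrib, Finset.sum_const, Finset.card_range, nsmul_eq_mul] at h1
  rw [inv_mul_lt_iff₀ hN0'] at hN ⊢
  linarith

theorem comp_mul {w : ℕ → ℂ} (hw : StronglyCesaroNull w) {k : ℕ} (hk : 0 < k) :
    StronglyCesaroNull (fun n => w (k * n)) := by
  have h1 := (hw.comp (tendsto_id.const_mul_atTop' hk)).const_mul (k : ℝ)
  rw [mul_zero] at h1
  refine squeeze_zero (fun N => by positivity) (fun N => ?_) h1
  have hk' : (k : ℝ) ≠ 0 := by positivity
  have h2 : ∑ n ∈ Finset.range N, ‖w (k * n)‖ ≤ ∑ n ∈ Finset.range (k * N), ‖w n‖ := by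
    have hinj : Set.InjOn (fun n => k * n) (Finset.range N : Set ℕ) :=
      fun i _ j _ hij => Nat.eq_of_mul_eq_mul_left hk hij
    rw [← Finset.sum_image (f := fun n => ‖w n‖) hinj]
    refine Finset.sum_le_sum_of_subset_of_nonneg ?_ fun _ _ _ => norm_nonneg _
    intro i hi
    obtain ⟨n, hn, rfl⟩ := Finset.mem_image.1 hi
    have := Finset.mem_range.1 hn
    exact Finset.mem_range.2 (by gcongr)
  simp only [Function.comp_apply, id_eq, Nat.cast_mul, mul_inv]
  rw [← mul_assoc, mul_inv_cancel_left₀ hk']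
  gcongr

end StronglyCesaroNull

/-- For fixed `i`, each distance occurs at most once with `j ≤ i` and at most once with `j > i`. -/
theorem sum_sum_dist_le {g : ℕ → ℝ} (hg : ∀ n, 0 ≤ g n) (N : ℕ) :
    ∑ i ∈ Finset.range N, ∑ j ∈ Finset.range N, g (Nat.dist i j) ≤
      2 * N * ∑ n ∈ Finset.range N, g n := by
  have key : ∀ i ∈ Finset.range N, ∑ j ∈ Finset.range N, g (Nat.dist i j) ≤
      2 * ∑ n ∈ Finset.range N, g n := by
    intro i hi
    have hi' := Finset.mem_range.1 hi
    rw [← Finset.sum_filter_add_sum_filter_not _ (fun j => j ≤ i), two_mul]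
    refine add_le_add ?_ ?_
    · have hinj : Set.InjOn (fun j => Nat.dist i j)
          ((Finset.range N).filter fun j => j ≤ i : Finset ℕ) := by
        intro j hj l hl hjl
        simp only [Finset.coe_filter, Set.mem_ofPred_eq, Nat.dist] at hj hl hjl
        omega
      rw [← Finset.sum_image (f := g) hinj]
      refine Finset.sum_le_sum_of_subset_of_nonneg ?_ fun _ _ _ => hg _
      intro l hl
      obtain ⟨j, hj, rfl⟩ := Finset.mem_image.1 hl
      simp only [Finset.mem_filter, Finset.mem_range, Nat.dist] at hj ⊢
      omega
    · have hinj : Set.InjOn (fun j => Nat.dist i j)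
          ((Finset.range N).filter fun j => ¬ j ≤ i : Finset ℕ) := by
        intro j hj l hl hjl
        simp only [Finset.coe_filter, Set.mem_ofPred_eq, Nat.dist] at hj hl hjl
        omega
      rw [← Finset.sum_image (f := g) hinj]
      refine Finset.sum_le_sum_of_subset_of_nonneg ?_ fun _ _ _ => hg _
      intro l hl
      obtain ⟨j, hj, rfl⟩ := Finset.mem_image.1 hl
      simp only [Finset.mem_filter, Finset.mem_range, Nat.dist] at hj ⊢
      omega
  refine (Finset.sum_le_sum key).trans (le_of_eq ?_)
  rw [Finset.sum_const, Finset.card_range, nsmul_eq_mul]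
  ring

variable {E : Type*} [NormedAddCommGroup E] [InnerProductSpace ℂ E] (V : E →ₗᵢ[ℂ] E)

theorem LinearIsometry.inner_linearMap_pow_add (m i j : ℕ) (v w : E) :
    inner ℂ ((V.toLinearMap ^ (m + i)) v) ((V.toLinearMap ^ (m + j)) w) =
      inner ℂ ((V.toLinearMap ^ i) v) ((V.toLinearMap ^ j) w) := by
  induction m with
  | zero => simp
  | succ m ih =>
    rw [add_right_comm, add_right_comm m 1 j, pow_succ', pow_succ', Module.End.mul_apply,
      Module.End.mul_apply, LinearIsometry.coe_toLinearMap, V.inner_map_map, ih]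

theorem LinearIsometry.norm_inner_linearMap_pow (i j : ℕ) (v : E) :
    ‖inner ℂ ((V.toLinearMap ^ i) v) ((V.toLinearMap ^ j) v)‖ =
      ‖inner ℂ v ((V.toLinearMap ^ (Nat.dist i j)) v)‖ := by
  rcases le_total i j with hij | hij
  · obtain ⟨l, rfl⟩ := Nat.exists_eq_add_of_le hij
    have := V.inner_linearMap_pow_add i 0 l v v
    rw [add_zero] at this
    rw [this, Nat.dist_eq_sub_of_le hij, Nat.add_sub_cancel_left]
    simp
  · obtain ⟨l, rfl⟩ := Nat.exists_eq_add_of_le hij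
    have := V.inner_linearMap_pow_add j l 0 v v
    rw [add_zero] at this
    rw [this, Nat.dist_eq_sub_of_le_right hij, Nat.add_sub_cancel_left, norm_inner_symm]
    simp

theorem norm_sum_sq_le_sum_norm_inner {ι : Type*} (s : Finset ι) (v : ι → E) :
    ‖∑ i ∈ s, v i‖ ^ 2 ≤ ∑ i ∈ s, ∑ j ∈ s, ‖inner ℂ (v i) (v j)‖ := by
  rw [← inner_self_eq_norm_sq (𝕜 := ℂ), sum_inner, map_sum]
  simp_rw [inner_sum, map_sum]
  gcongr
  exact Complex.re_le_norm _

/-- Expanding the squared norm leaves correlations that depend, in absolute value, only on the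
distance of the indices. Its normalised value is thus at most twice a Cesàro average along multiples
of `k`. -/
theorem tendsto_average_pow_zero_of_stronglyCesaroNull {v : E}
    (h : StronglyCesaroNull fun n => inner ℂ v ((V.toLinearMap ^ n) v)) {k : ℕ} (hk : 0 < k) :
    Tendsto (fun N : ℕ => (N : ℂ)⁻¹ • ∑ n ∈ Finset.range N, (V.toLinearMap ^ (k * n)) v)
      atTop (𝓝 0) := by
  have h1 := (Tendsto.const_mul 2 (h.comp_mul hk)).sqrt
  rw [mul_zero, Real.sqrt_zero] at h1
  refine squeeze_zero_norm (fun N => Real.le_sqrt_of_sq_le ?_) h1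
  have h2 : ‖∑ n ∈ Finset.range N, (V.toLinearMap ^ (k * n)) v‖ ^ 2 ≤
      2 * N * ∑ n ∈ Finset.range N, ‖inner ℂ v ((V.toLinearMap ^ (k * n)) v)‖ := by
    refine (norm_sum_sq_le_sum_norm_inner _ _).trans ?_
    refine le_trans (le_of_eq ?_) (sum_sum_dist_le (fun n => norm_nonneg _) N)
    simp_rw [V.norm_inner_linearMap_pow, Nat.dist_mul_left]
  rw [norm_smul, norm_inv, Complex.norm_natCast, mul_pow]
  rcases Nat.eq_zero_or_pos N with rfl | hN
  · simp
  · have hN' : (0 : ℝ) < N := by exact_mod_cast hN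
    calc _ ≤ ((N : ℝ)⁻¹) ^ 2 *
          (2 * N * ∑ n ∈ Finset.range N, ‖inner ℂ v ((V.toLinearMap ^ (k * n)) v)‖) := by gcongr
      _ = _ := by field_simp

end Averages

/-! ### Weak mixing and decay of correlations along blocks -/

section WeakMixing

variable {X : Type*} [MeasurableSpace X] {μ : Measure X} {T : X ≃ᵐ X}

theorem IsWeaklyMixing.stronglyCesaroNull_indicator (hT : IsWeaklyMixing μ T) {A B : Set X}
    (hA : MeasurableSet A) (hB : MeasurableSet B) :
    StronglyCesaroNull fun n =>
      ((μ.real (A ∩ T^[n] ⁻¹' B) - μ.real A * μ.real B : ℝ) : ℂ) := by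
  set r : ℕ → ℝ := fun n => |μ.real (A ∩ T^[n] ⁻¹' B) - μ.real A * μ.real B| with hr
  -- The definition averages over `1, …, N`; the term at `0` is added and vanishes after division by
  -- `N`.
  have h1 : Tendsto (fun N : ℕ => (N : ℝ)⁻¹ * (r 0 + ∑ n ∈ Finset.Icc 1 N, r n)) atTop (𝓝 0) := by
    have := (tendsto_inv_atTop_zero.comp (tendsto_natCast_atTop_atTop (R := ℝ))).mul_const (r 0)
    simpa [mul_add] using this.add (hT.tendsto_average A B hA hB)
  refine squeeze_zero (fun N => by positivity) (fun N => ?_) h1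
  gcongr
  simp only [Complex.norm_real, Real.norm_eq_abs]
  have hr0 : ∀ n, 0 ≤ r n := fun n => abs_nonneg _
  have h2 : r 0 + ∑ n ∈ Finset.Icc 1 N, r n = ∑ n ∈ Finset.range (N + 1), r n := by
    rw [Finset.sum_range_succ', add_comm, Finset.range_eq_Ico,
      Finset.sum_Ico_add' r 0 N 1, zero_add, Finset.Ico_add_one_right_eq_Icc]
  rw [h2, Finset.sum_range_succ]
  linarith [hr0 N]

variable [IsProbabilityMeasure μ]

/-- In a weakly mixing system the correlations of `L²` functions converge strongly Cesàro. -/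
theorem IsWeaklyMixing.stronglyCesaroNull_inner (hT : IsWeaklyMixing μ T) (f g : Lp ℂ 2 μ) :
    StronglyCesaroNull fun n =>
      inner ℂ f (((Lp.compMeasurePreservingₗᵢ ℂ T hT.measurePreserving :
        Lp ℂ 2 μ →ₗᵢ[ℂ] Lp ℂ 2 μ).toLinearMap ^ n) g) -
      inner ℂ f (boundedMeasurable.toLp μ 1) * inner ℂ (boundedMeasurable.toLp μ 1) g := by
  set U := (Lp.compMeasurePreservingₗᵢ ℂ T hT.measurePreserving : Lp ℂ 2 μ →ₗᵢ[ℂ] Lp ℂ 2 μ) with hU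
  set e : Lp ℂ 2 μ := boundedMeasurable.toLp μ 1 with he
  set w : Lp ℂ 2 μ → Lp ℂ 2 μ → ℕ → ℂ := fun f g n =>
    inner ℂ f ((U.toLinearMap ^ n) g) - inner ℂ f e * inner ℂ e g with hw
  have hebound : ‖e‖ ≤ 1 :=
    boundedMeasurable.norm_toLp_le μ zero_le_one fun _ => by simp
  -- A bound uniform in `n` makes the good vectors a closed set, so `Lp.induction` in each argument
  -- reduces the claim to indicators.
  have hbound : ∀ f g n, ‖w f g n‖ ≤ 2 * ‖f‖ * ‖g‖ := by
    intro f g n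
    refine (norm_sub_le _ _).trans ?_
    have h1 := norm_inner_le_norm (𝕜 := ℂ) f ((U.toLinearMap ^ n) g)
    rw [U.norm_linearMap_pow_apply] at h1
    have h2 : ‖(inner ℂ f e * inner ℂ e g : ℂ)‖ ≤ (‖f‖ * 1) * (1 * ‖g‖) := by
      rw [norm_mul]
      gcongr
      · exact (norm_inner_le_norm _ _).trans (by gcongr)
      · exact (norm_inner_le_norm _ _).trans (by gcongr)
    linarith
  have haddr : ∀ f g g' n, w f (g + g') n = w f g n + w f g' n := fun f g g' n => by
    simp only [hw, map_add, inner_add_right]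
    ring
  have haddl : ∀ f f' g n, w (f + f') g n = w f g n + w f' g n := fun f f' g n => by
    simp only [hw, inner_add_left]
    ring
  have hsubr : ∀ f g g' n, w f g n - w f g' n = w f (g - g') n := fun f g g' n => by
    simp only [hw, map_sub, inner_sub_right]
    ring
  have hsubl : ∀ f f' g n, w f g n - w f' g n = w (f - f') g n := fun f f' g n => by
    simp only [hw, inner_sub_left]
    ring
  have hsmulr : ∀ (c : ℂ) f g n, w f (c • g) n = c * w f g n := fun c f g n => by
    simp only [hw, map_smul, inner_smul_right]
    ring
  have hsmull : ∀ (c : ℂ) f g n, w (c • f) g n = star c * w f g n := fun c f g n => by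
    simp only [hw, inner_smul_left, RCLike.star_def]
    ring
  have hind : ∀ {A : Set X} (hA : MeasurableSet A) (c : ℂ),
      indicatorConstLp 2 hA (measure_ne_top μ A) c =
        c • indicatorConstLp 2 hA (measure_ne_top μ A) (1 : ℂ) := by
    intro A hA c
    ext1
    filter_upwards [indicatorConstLp_coeFn (p := 2) (hs := hA) (hμs := measure_ne_top μ A) (c := c),
      indicatorConstLp_coeFn (p := 2) (hs := hA) (hμs := measure_ne_top μ A) (c := (1 : ℂ)),
      Lp.coeFn_smul c (indicatorConstLp 2 hA (measure_ne_top μ A) (1 : ℂ))] with x h1 h2 h3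
    rw [h1, h3, Pi.smul_apply, h2]
    by_cases hx : x ∈ A <;> simp [hx]
  have hone : e = indicatorConstLp 2 MeasurableSet.univ (measure_ne_top μ _) (1 : ℂ) := by
    rw [indicatorConstLp_univ]
    rfl
  have hUind : ∀ {A : Set X} (hA : MeasurableSet A) (n : ℕ),
      (U.toLinearMap ^ n) (indicatorConstLp 2 hA (measure_ne_top μ A) (1 : ℂ)) =
      indicatorConstLp 2 ((T.measurable.iterate n) hA) (measure_ne_top μ _) (1 : ℂ) := by
    intro A hA n
    induction n generalizing A with
    | zero => rfl
    | succ n ih =>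
      rw [pow_succ, Module.End.mul_apply]
      have : U.toLinearMap (indicatorConstLp 2 hA (measure_ne_top μ A) (1 : ℂ)) =
        indicatorConstLp 2 (T.measurable hA) (measure_ne_top μ _) (1 : ℂ) := rfl
      rw [this, ih (T.measurable hA)]
      simp only [Function.iterate_succ', Set.preimage_comp]
  have hbase : ∀ {A B : Set X} (hA : MeasurableSet A) (hB : MeasurableSet B),
      StronglyCesaroNull (w (indicatorConstLp 2 hA (measure_ne_top μ A) (1 : ℂ))
        (indicatorConstLp 2 hB (measure_ne_top μ B) (1 : ℂ))) := by
    intro A B hA hB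
    refine (hT.stronglyCesaroNull_indicator hA hB).congr fun N => ?_
    congr 1
    refine Finset.sum_congr rfl fun n _ => ?_
    simp only [hw]
    rw [hUind hB n, hone, L2.inner_indicatorConstLp_one_indicatorConstLp_one,
      L2.inner_indicatorConstLp_one_indicatorConstLp_one,
      L2.inner_indicatorConstLp_one_indicatorConstLp_one, Set.inter_univ, Set.univ_inter]
    push_cast
    rfl
  have hclosed : ∀ v : Lp ℂ 2 μ → ℕ → ℂ, (∃ K : ℝ, 0 ≤ K ∧ ∀ g g' n, ‖v g n - v g' n‖ ≤ K * ‖g - g'‖) →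
      IsClosed {g | StronglyCesaroNull (v g)} := by
    rintro v ⟨K, hK, hv⟩
    refine isClosed_of_closure_subset fun g hg => ?_
    refine .of_approx fun ε hε => ?_
    obtain ⟨g', hg', hgg'⟩ := Metric.mem_closure_iff.1 hg (ε / (K + 1)) (by positivity)
    refine ⟨v g', hg', fun n => (hv g g' n).trans ?_⟩
    rw [dist_eq_norm, lt_div_iff₀ (by positivity)] at hgg'
    nlinarith [norm_nonneg (g - g')]
  have hstep : ∀ {A : Set X} (hA : MeasurableSet A) (g : Lp ℂ 2 μ),
      StronglyCesaroNull (w (indicatorConstLp 2 hA (measure_ne_top μ A) (1 : ℂ)) g) := by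
    intro A hA g
    set a := indicatorConstLp 2 hA (measure_ne_top μ A) (1 : ℂ)
    refine Lp.induction (by simp) (fun g => StronglyCesaroNull (w a g)) ?_ ?_ ?_ g
    · intro c B hB hμB
      rw [Lp.simpleFunc.coe_indicatorConst, hind hB c]
      exact ((hbase hA hB).const_mul c).congr fun N => by simp only [hsmulr]; rfl
    · intro g g' hg hg' _ h h'
      exact (h.add h').congr fun N => by simp only [haddr]
    · exact hclosed _ ⟨2 * ‖a‖, by positivity, fun g g' n => by rw [hsubr]; exact hbound _ _ _⟩
  refine Lp.induction (by simp) (fun f => StronglyCesaroNull (w f g)) ?_ ?_ ?_ f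
  · intro c B hB hμB
    rw [Lp.simpleFunc.coe_indicatorConst, hind hB c]
    exact ((hstep hB g).const_mul (star c)).congr fun N => by simp only [hsmull]
  · intro f f' hf hf' _ h h'
    exact (h.add h').congr fun N => by simp only [haddl]
  · refine hclosed (fun f => w f g) ⟨2 * ‖g‖, by positivity, fun f f' n => ?_⟩
    rw [hsubl, mul_right_comm]
    exact hbound _ _ _

open TensorProduct in
/-- Autocorrelations of mean-zero functions along differences of blocks of integer Cantor sets
tend to zero on average. -/
theorem IsWeaklyMixing.tendsto_average_cantorBlock_mean (hT : IsWeaklyMixing μ T) {b : ℕ}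
    {D : Finset ℕ} (h : IsClassicalDigitSet b D) (h0 : 0 ∈ D) {g : boundedMeasurable X}
    (hg : boundedMeasurable.mean μ g = 0) {a : ℕ} (ha : 0 < a) :
    Tendsto (fun m : ℕ => (((D.card : ℝ) ^ m) ^ 2)⁻¹ *
      ∑ z ∈ cantorBlock b D m, ∑ w ∈ cantorBlock b D m,
        ‖boundedMeasurable.mean μ (star (boundedMeasurable.koopman T (a * z) g) *
          boundedMeasurable.koopman T (a * w) g)‖) atTop (𝓝 0) := by
  set U := (Lp.compMeasurePreservingₗᵢ ℂ T hT.measurePreserving : Lp ℂ 2 μ →ₗᵢ[ℂ] Lp ℂ 2 μ) with hU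
  set f := boundedMeasurable.toLp μ g with hf
  set f' := boundedMeasurable.toLp μ (star g) with hf'
  set V := TensorProduct.mapIsometry U U with hV
  -- Tensoring with the conjugate turns correlations into their squared absolute values, so no
  -- cancellation can hide in the norm of a block average.
  set F := f ⊗ₜ[ℂ] f' with hF
  have hpow : ∀ n, (V.toLinearMap ^ n) F =
      ((U.toLinearMap ^ n) f) ⊗ₜ[ℂ] ((U.toLinearMap ^ n) f') := by
    intro n
    induction n with
    | zero => rfl
    | succ n ih =>
      rw [pow_succ', Module.End.mul_apply, ih, pow_succ', Module.End.mul_apply,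
        Module.End.mul_apply]
      simp [hV]
  have hmean : ∀ i j, inner ℂ ((U.toLinearMap ^ i) f) ((U.toLinearMap ^ j) f) =
      boundedMeasurable.mean μ (star (boundedMeasurable.koopman T i g) *
        boundedMeasurable.koopman T j g) := by
    intro i j
    rw [hf, hU, boundedMeasurable.compMeasurePreserving_pow_toLp,
      boundedMeasurable.compMeasurePreserving_pow_toLp, boundedMeasurable.inner_toLp]
  have hinner : ∀ i j, inner ℂ ((V.toLinearMap ^ i) F) ((V.toLinearMap ^ j) F) =
      ((‖inner ℂ ((U.toLinearMap ^ i) f) ((U.toLinearMap ^ j) f)‖ ^ 2 : ℝ) : ℂ) := by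
    intro i j
    have hstar : inner ℂ ((U.toLinearMap ^ i) f') ((U.toLinearMap ^ j) f') =
        star (inner ℂ ((U.toLinearMap ^ i) f) ((U.toLinearMap ^ j) f)) := by
      rw [hmean, ← boundedMeasurable.mean_star, hf', hU,
        boundedMeasurable.compMeasurePreserving_pow_toLp,
        boundedMeasurable.compMeasurePreserving_pow_toLp, boundedMeasurable.inner_toLp]
      simp only [map_star, star_mul, star_star, mul_comm]
    rw [hpow, hpow, TensorProduct.inner_tmul, hstar, RCLike.star_def, Complex.mul_conj,
      Complex.normSq_eq_norm_sq]
  have hnull : StronglyCesaroNull fun n => inner ℂ F ((V.toLinearMap ^ n) F) := by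
    have h1 := hT.stronglyCesaroNull_inner f f
    have h2 : inner ℂ (boundedMeasurable.toLp μ 1) f = 0 := by
      rw [hf, boundedMeasurable.inner_toLp, star_one, one_mul, hg]
    simp only [h2, mul_zero, sub_zero] at h1
    -- One factor of the squared correlation is bounded by `‖f‖ * ‖f‖`.
    refine .of_le (v := fun n => ‖f‖ * ‖f‖ * ‖inner ℂ f ((U.toLinearMap ^ n) f)‖) ?_ fun n => ?_
    · simpa [← Finset.mul_sum, mul_left_comm] using Tendsto.const_mul (‖f‖ * ‖f‖) h1
    · have h3 := hinner 0 n
      simp only [pow_zero, Module.End.one_apply] at h3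
      rw [h3, Complex.norm_real, Real.norm_of_nonneg (by positivity), sq]
      gcongr
      refine (norm_inner_le_norm _ _).trans ?_
      rw [U.norm_linearMap_pow_apply]
  have hblock := tendsto_average_cantorBlock_zero V h h0
    (fun k hk => tendsto_average_pow_zero_of_stronglyCesaroNull V hnull hk) ha
  rw [tendsto_zero_iff_norm_tendsto_zero] at hblock
  refine squeeze_zero (fun m => by positivity) (fun m => ?_) hblock
  set Q : ℝ := (D.card : ℝ) ^ m with hQ
  have hQpos : 0 < Q := pow_pos (by exact_mod_cast h.card_pos) m
  set S := ∑ z ∈ cantorBlock b D m, (V.toLinearMap ^ (a * z)) F with hS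
  have hsq : ‖S‖ ^ 2 = ∑ p ∈ cantorBlock b D m ×ˢ cantorBlock b D m,
      ‖inner ℂ ((U.toLinearMap ^ (a * p.1)) f) ((U.toLinearMap ^ (a * p.2)) f)‖ ^ 2 := by
    rw [← inner_self_eq_norm_sq (𝕜 := ℂ), hS, sum_inner, Finset.sum_product, map_sum]
    refine Finset.sum_congr rfl fun z _ => ?_
    rw [inner_sum, map_sum]
    refine Finset.sum_congr rfl fun w _ => ?_
    rw [hinner]
    exact Complex.ofReal_re _
  simp_rw [← hmean]
  rw [← Finset.sum_product' (f := fun z w =>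
    ‖inner ℂ ((U.toLinearMap ^ (a * z)) f) ((U.toLinearMap ^ (a * w)) f)‖),
    inv_mul_le_iff₀ (by positivity), norm_smul, norm_inv, norm_pow, Complex.norm_natCast, ← hQ]
  rw [show Q ^ 2 * (Q⁻¹ * ‖S‖) = Q * ‖S‖ by field_simp]
  -- Cauchy–Schwarz over pairs `(z, w)` passes from squared correlations to correlations.
  refine (le_abs_self _).trans (abs_le_of_sq_le_sq ?_ (by positivity))
  refine sq_sum_le_card_mul_sum_sq.trans (le_of_eq ?_)
  rw [mul_pow, hsq, Finset.card_product, h.card_cantorBlock, hQ]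
  push_cast
  ring

end WeakMixing

/-! ### Multiple averages by induction on the number of functions -/

section Main

open boundedMeasurable

variable {X : Type*} [MeasurableSpace X] {μ : Measure X} {T : X ≃ᵐ X}
  {b : ℕ} {D : Finset ℕ}

theorem exists_boundedMeasurable_ae_eq {f : X → ℂ} (hf : MemLp f ∞ μ) :
    ∃ g : boundedMeasurable X, f =ᵐ[μ] g := by
  set F := hf.1.mk f with hF
  have hFm : Measurable F := hf.1.stronglyMeasurable_mk.measurable
  obtain ⟨C, hC⟩ : ∃ C : ℝ, ∀ᵐ x ∂μ, ‖f x‖ ≤ C := by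
    refine ⟨(eLpNormEssSup f μ).toReal, ?_⟩
    have hlt : eLpNormEssSup f μ < ∞ := by simpa using hf.2
    filter_upwards [enorm_ae_le_eLpNormEssSup f μ] with x hx
    rw [← toReal_enorm]
    exact ENNReal.toReal_mono hlt.ne hx
  have hset : MeasurableSet {x | ‖F x‖ ≤ C} := measurableSet_le hFm.norm measurable_const
  refine ⟨⟨{x | ‖F x‖ ≤ C}.indicator F, hFm.indicator hset, |C|, fun x => ?_⟩, ?_⟩
  · by_cases hx : x ∈ {x | ‖F x‖ ≤ C}
    · rw [Set.indicator_of_mem hx]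
      exact le_trans hx (le_abs_self C)
    · rw [Set.indicator_of_notMem hx, norm_zero]
      exact abs_nonneg C
  · filter_upwards [hC, hf.1.ae_eq_mk] with x hx hfx
    have : x ∈ {x | ‖F x‖ ≤ C} := by
      change ‖F x‖ ≤ C
      rw [hF, ← hfx]
      exact hx
    change f x = {x | ‖F x‖ ≤ C}.indicator F x
    rw [Set.indicator_of_mem this, hfx]

theorem cantorAverage_ae_eq (hT : MeasurePreserving T μ μ) {t : ℕ} {f g : Fin t → X → ℂ}
    (hfg : ∀ s, f s =ᵐ[μ] g s) (N : ℕ) :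
    cantorAverage b D T f N =ᵐ[μ] cantorAverage b D T g N := by
  have h1 : ∀ᵐ x ∂μ, ∀ n s, f s (T^[((s : ℕ) + 1) * cantorSeq b D n] x) =
      g s (T^[((s : ℕ) + 1) * cantorSeq b D n] x) :=
    ae_all_iff.2 fun n => ae_all_iff.2 fun s =>
      (hT.iterate _).quasiMeasurePreserving.ae_eq_comp (hfg s)
  filter_upwards [h1] with x hx
  simp only [cantorAverage, hx]

variable [IsProbabilityMeasure μ]

theorem boundedMeasurable.exists_pos_bound (g : boundedMeasurable X) :
    ∃ C : ℝ, 0 < C ∧ ∀ x, ‖(g : X → ℂ) x‖ ≤ C := by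
  obtain ⟨C, hC⟩ := g.2.2
  exact ⟨|C| + 1, by positivity, fun x => (hC x).trans (by linarith [le_abs_self C])⟩

theorem boundedMeasurable.prod_apply {ι : Type*} (s : Finset ι) (f : ι → boundedMeasurable X)
    (x : X) : ((∏ i ∈ s, f i : boundedMeasurable X) : X → ℂ) x = ∏ i ∈ s, (f i : X → ℂ) x := by
  have := congrFun (map_prod (boundedMeasurable X).subtype f s) x
  rw [Finset.prod_apply] at this
  exact this

/-- The multiple averages along the integer Cantor set with the exponents `a` converge in `L²` to
the product of the means. -/
def MultipleConvergence (μ : Measure X) [IsProbabilityMeasure μ] (T : X ≃ᵐ X) (b : ℕ)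
    (D : Finset ℕ) {t : ℕ} (a : Fin t → ℕ) (f : Fin t → boundedMeasurable X) : Prop :=
  Tendsto (fun x => ((cantorInitial b D x).card : ℂ)⁻¹ •
    ∑ k ∈ cantorInitial b D x, toLp μ (∏ s, koopman T (a s * k) (f s))) atTop
    (𝓝 ((∏ s, mean μ (f s)) • toLp μ 1))

theorem eventually_card_cantorInitial_pos (h : IsClassicalDigitSet b D) (h0 : 0 ∈ D) :
    ∀ᶠ x in atTop, 0 < (cantorInitial b D x).card :=
  (tendsto_card_cantorInitial h h0).eventually_gt_atTop 0

/-- The inductive step. The hypothesis must cover general exponents, since it is applied to `(a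
s.succ - a 0) * b ^ m`. -/
theorem multipleConvergence_of_mean_eq_zero (hT : IsWeaklyMixing μ T)
    (h : IsClassicalDigitSet b D) (h0 : 0 ∈ D) {t : ℕ}
    (ih : ∀ (a : Fin t → ℕ), StrictMono a → (∀ s, 0 < a s) → ∀ f : Fin t → boundedMeasurable X,
      MultipleConvergence μ T b D a f)
    {a : Fin (t + 1) → ℕ} (ha : StrictMono a) (ha0 : ∀ s, 0 < a s)
    (f : Fin (t + 1) → boundedMeasurable X) {r : Fin (t + 1)} (hr : mean μ (f r) = 0) :
    MultipleConvergence μ T b D a f := by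
  have hT' := hT.measurePreserving
  rw [MultipleConvergence, Finset.prod_eq_zero (Finset.mem_univ r) hr, zero_smul]
  choose C hC0 hC using fun s => boundedMeasurable.exists_pos_bound (f s)
  set u : ℕ → Lp ℂ 2 μ := fun k => toLp μ (∏ s, koopman T (a s * k) (f s)) with hu
  have hubound : ∀ k, ‖u k‖ ≤ ∏ s, C s := fun k => by
    refine norm_toLp_le μ (Finset.prod_nonneg fun s _ => (hC0 s).le) fun x => ?_
    rw [boundedMeasurable.prod_apply, norm_prod]
    exact Finset.prod_le_prod (fun _ _ => norm_nonneg _) fun s _ => hC s _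
  set G : ℕ → ℕ → Fin (t + 1) → boundedMeasurable X := fun z w s =>
    star (koopman T (a s * z) (f s)) * koopman T (a s * w) (f s) with hG
  -- Invariance of `μ` under `T^(a 0 * b^m * y)` frees the factor `s = 0` of `y`.
  have hinner : ∀ m z w y, inner ℂ (u (z + b ^ m * y)) (u (w + b ^ m * y)) =
      inner ℂ (toLp μ (star (G z w 0))) (toLp μ
        (∏ s : Fin t, koopman T ((a s.succ - a 0) * b ^ m * y) (G z w s.succ))) := by
    intro m z w y
    rw [hu, inner_toLp, inner_toLp, star_star, star_prod, ← Finset.prod_mul_distrib]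
    have h1 : ∀ s, star (koopman T (a s * (z + b ^ m * y)) (f s)) *
        koopman T (a s * (w + b ^ m * y)) (f s) =
        koopman T (a 0 * (b ^ m * y)) (koopman T ((a s - a 0) * b ^ m * y) (G z w s)) := by
      intro s
      simp only [hG, map_mul, map_star, koopman_koopman]
      have h2 : a 0 ≤ a s := ha.monotone (Fin.zero_le s)
      obtain ⟨c, hc⟩ := Nat.exists_eq_add_of_le h2
      rw [hc, Nat.add_sub_cancel_left]
      congr 3 <;> ring_nf
    simp_rw [h1]
    rw [← map_prod, mean_koopman hT', Fin.prod_univ_succ]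
    congr 2
    rw [Nat.sub_self, zero_mul, zero_mul]
    rfl
  have hlim : ∀ m z w, Tendsto (fun x => ((cantorInitial b D x).card : ℂ)⁻¹ *
      ∑ y ∈ cantorInitial b D x, inner ℂ (u (z + b ^ m * y)) (u (w + b ^ m * y))) atTop
      (𝓝 (∏ s, mean μ (G z w s))) := by
    intro m z w
    have h1 := ih (fun s => (a s.succ - a 0) * b ^ m)
      (fun i j hij => by
        have h2 : a i.succ < a j.succ := ha (Fin.succ_lt_succ_iff.2 hij)
        have h3 : a 0 < a i.succ := ha (Fin.succ_pos i)
        have h4 := pow_pos h.base_pos m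
        dsimp only
        gcongr
        omega)
      (fun s => by
        have h3 : a 0 < a s.succ := ha (Fin.succ_pos s)
        exact Nat.mul_pos (by omega) (pow_pos h.base_pos m))
      (fun s => G z w s.succ)
    have h2 := (tendsto_const_nhds (x := toLp μ (star (G z w 0)))).inner (𝕜 := ℂ) h1
    rw [inner_smul_right, inner_toLp, star_star, mul_one, mul_comm, ← Fin.prod_univ_succ
      (f := fun s => mean μ (G z w s))] at h2
    refine h2.congr fun x => ?_
    rw [inner_smul_right, inner_sum]
    simp_rw [hinner]
  -- Only the factor `r` has to be small; the others are bounded uniformly in `z` and `w`.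
  have hmean : ∀ z w, ‖∏ s, mean μ (G z w s)‖ ≤
      (∏ s ∈ Finset.univ.erase r, C s * C s) * ‖mean μ (G z w r)‖ := by
    intro z w
    rw [norm_prod, ← Finset.prod_erase_mul _ _ (Finset.mem_univ r)]
    gcongr with s
    refine norm_mean_le μ fun x => ?_
    refine (norm_mul_le _ _).trans ?_
    refine mul_le_mul ((norm_star _).trans_le (hC s _)) (hC s _) (norm_nonneg _) (hC0 s).le
  refine tendsto_average_cantorInitial_zero h h0 hubound fun ε hε => ?_
  set K : ℝ := ∏ s ∈ Finset.univ.erase r, C s * C s with hK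
  have hKpos : 0 < K := Finset.prod_pos fun s _ => mul_pos (hC0 s) (hC0 s)
  have hcor := hT.tendsto_average_cantorBlock_mean h h0 hr (ha0 r)
  obtain ⟨m, hm⟩ := (hcor.eventually_lt_const (show 0 < ε / K by positivity)).exists
  refine ⟨m, ?_⟩
  set Q : ℝ := (D.card : ℝ) ^ m with hQ
  have hQpos : 0 < Q := pow_pos (by exact_mod_cast h.card_pos) m
  have hsum : Tendsto (fun x => ∑ z ∈ cantorBlock b D m, ∑ w ∈ cantorBlock b D m,
      ((cantorInitial b D x).card : ℂ)⁻¹ *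
      ∑ y ∈ cantorInitial b D x, inner ℂ (u (z + b ^ m * y)) (u (w + b ^ m * y))) atTop
      (𝓝 (∑ z ∈ cantorBlock b D m, ∑ w ∈ cantorBlock b D m, ∏ s, mean μ (G z w s))) :=
    tendsto_finsetSum _ fun z _ => tendsto_finsetSum _ fun w _ => hlim m z w
  have hlt : ‖∑ z ∈ cantorBlock b D m, ∑ w ∈ cantorBlock b D m, ∏ s, mean μ (G z w s)‖ <
      ε * Q ^ 2 := by
    rw [inv_mul_lt_iff₀ (by positivity), mul_div_assoc', lt_div_iff₀ hKpos] at hm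
    calc _ ≤ ∑ z ∈ cantorBlock b D m, ∑ w ∈ cantorBlock b D m, K * ‖mean μ (G z w r)‖ :=
          norm_sum_le_of_le _ fun z _ => norm_sum_le_of_le _ fun w _ => hmean z w
      _ = (∑ z ∈ cantorBlock b D m, ∑ w ∈ cantorBlock b D m, ‖mean μ (G z w r)‖) * K := by
          simp_rw [← Finset.mul_sum, mul_comm]
      _ < Q ^ 2 * ε := hm
      _ = ε * Q ^ 2 := mul_comm _ _
  filter_upwards [hsum.norm.eventually_lt_const hlt, eventually_card_cantorInitial_pos h h0]
    with x hx hx0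
  have hx0' : (0 : ℝ) < (cantorInitial b D x).card := by exact_mod_cast hx0
  simp_rw [← Finset.mul_sum] at hx
  rw [norm_mul, norm_inv, Complex.norm_natCast, inv_mul_lt_iff₀ hx0'] at hx
  have hexpand : ∑ y ∈ cantorInitial b D x, ‖∑ z ∈ cantorBlock b D m, u (z + b ^ m * y)‖ ^ 2 =
      (∑ z ∈ cantorBlock b D m, ∑ w ∈ cantorBlock b D m, ∑ y ∈ cantorInitial b D x,
        inner ℂ (u (z + b ^ m * y)) (u (w + b ^ m * y))).re := by
    simp_rw [Finset.sum_comm (t := cantorInitial b D x)]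
    rw [Complex.re_sum]
    refine Finset.sum_congr rfl fun y _ => ?_
    simp_rw [← inner_sum, ← sum_inner]
    exact (inner_self_eq_norm_sq (𝕜 := ℂ) _).symm
  rw [hexpand]
  refine (Complex.re_le_norm _).trans (hx.le.trans (le_of_eq ?_))
  ring

theorem multipleConvergence_of_forall_eq (h : IsClassicalDigitSet b D) (h0 : 0 ∈ D) {t : ℕ}
    {a : Fin t → ℕ} {f : Fin t → boundedMeasurable X}
    (hf : ∀ s, f s = algebraMap ℂ (boundedMeasurable X) (mean μ (f s))) :
    MultipleConvergence μ T b D a f := by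
  refine tendsto_const_nhds.congr' ?_
  filter_upwards [eventually_card_cantorInitial_pos h h0] with x hx
  have h1 : ∀ k, ∏ s, koopman T (a s * k) (f s) =
      algebraMap ℂ (boundedMeasurable X) (∏ s, mean μ (f s)) := fun k => by
    rw [map_prod]
    refine Finset.prod_congr rfl fun s _ => ?_
    rw [hf s, AlgHomClass.commutes, ← hf s]
    exact hf s
  simp_rw [h1]
  rw [Finset.sum_const, ← Nat.cast_smul_eq_nsmul ℂ, inv_smul_smul₀ (by exact_mod_cast hx.ne'),
    Algebra.algebraMap_eq_smul_one, map_smul]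

/-- Stated for a family `φ` so as to cover both the means and the Koopman operators, whose exponents
depend on `s`. -/
theorem prod_update_add {ι A B : Type*} [Fintype ι] [DecidableEq ι] [Add A] [CommRing B]
    (f : ι → A) (r : ι) (g g' : A) (φ : ι → A → B) (hφ : φ r (g + g') = φ r g + φ r g') :
    ∏ s, φ s (Function.update f r (g + g') s) = ∏ s, φ s (Function.update f r g s) +
      ∏ s, φ s (Function.update f r g' s) := by
  simp_rw [← Finset.mul_prod_erase _ _ (Finset.mem_univ r), Function.update_self, hφ, add_mul]
  congr 2 <;> refine Finset.prod_congr rfl fun s hs => ?_ <;>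
    simp [Function.update_of_ne (Finset.ne_of_mem_erase hs)]

theorem multipleConvergence_update_add {t : ℕ} {a : Fin t → ℕ}
    {f : Fin t → boundedMeasurable X} {r : Fin t} {g g' : boundedMeasurable X}
    (hg : MultipleConvergence μ T b D a (Function.update f r g))
    (hg' : MultipleConvergence μ T b D a (Function.update f r g')) :
    MultipleConvergence μ T b D a (Function.update f r (g + g')) := by
  have h1 := Tendsto.add hg hg'
  rw [← add_smul, ← prod_update_add f r g g' (fun _ => mean μ) (map_add _ _ _)] at h1
  refine h1.congr fun x => ?_
  rw [← smul_add, ← Finset.sum_add_distrib]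
  congr 1
  refine Finset.sum_congr rfl fun k _ => ?_
  rw [← map_add, ← prod_update_add f r g g' (fun s => koopman T (a s * k)) (map_add _ _ _)]

theorem multipleConvergence_of_forall_mean_eq_zero (h : IsClassicalDigitSet b D) (h0 : 0 ∈ D) {t : ℕ} {a : Fin t → ℕ}
    (hzero : ∀ (f : Fin t → boundedMeasurable X) (r : Fin t), mean μ (f r) = 0 →
      MultipleConvergence μ T b D a f) (f : Fin t → boundedMeasurable X) :
    MultipleConvergence μ T b D a f := by
  -- Induction on a set `S` outside which the functions are constant: `f r = (f r - c) + c` yields a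
  -- tuple with a mean-zero entry and a tuple with one more constant.
  have key : ∀ (S : Finset (Fin t)) (f : Fin t → boundedMeasurable X),
      (∀ s ∉ S, f s = algebraMap ℂ (boundedMeasurable X) (mean μ (f s))) →
      MultipleConvergence μ T b D a f := by
    intro S
    induction S using Finset.induction_on with
    | empty => exact fun f hf => multipleConvergence_of_forall_eq h h0 fun s => hf s (by simp)
    | insert r S hrS ihS =>
      intro f hf
      set c := algebraMap ℂ (boundedMeasurable X) (mean μ (f r)) with hc
      have hmc : mean μ c = mean μ (f r) := by
        rw [hc, Algebra.algebraMap_eq_smul_one, map_smul, mean_one, smul_eq_mul, mul_one]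
      have h1 : f = Function.update f r ((f r - c) + c) := by simp
      rw [h1]
      refine multipleConvergence_update_add (hzero _ r ?_) (ihS _ fun s hs => ?_)
      · rw [Function.update_self, map_sub, hmc, sub_self]
      · rcases eq_or_ne s r with rfl | hsr
        · rw [Function.update_self, hmc]
        · rw [Function.update_of_ne hsr]
          exact hf s (by simp [hs, hsr])
  exact key Finset.univ f (by simp)

theorem multipleConvergence (hT : IsWeaklyMixing μ T) (h : IsClassicalDigitSet b D) (h0 : 0 ∈ D)
    {t : ℕ} (a : Fin t → ℕ) (ha : StrictMono a) (ha0 : ∀ s, 0 < a s)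
    (f : Fin t → boundedMeasurable X) : MultipleConvergence μ T b D a f := by
  induction t with
  | zero => exact multipleConvergence_of_forall_eq h h0 fun s => s.elim0
  | succ t ih =>
    exact multipleConvergence_of_forall_mean_eq_zero h h0
      (fun f _ hr => multipleConvergence_of_mean_eq_zero hT h h0 ih ha ha0 f hr) f

theorem boundedMeasurable.enorm_toLp (g : boundedMeasurable X) :
    ‖toLp μ g‖ₑ = eLpNorm (g : X → ℂ) 2 μ :=
  Lp.enorm_toLp (memLp μ g 2)

theorem boundedMeasurable.cantorAverage_eq {t : ℕ} (g : Fin t → boundedMeasurable X) (N : ℕ) :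
    ((((N : ℂ)⁻¹ • ∑ n ∈ Finset.range N,
      ∏ s : Fin t, koopman T (((s : ℕ) + 1) * cantorSeq b D n) (g s) : boundedMeasurable X) :
      X → ℂ)) = cantorAverage b D T (fun s => (g s : X → ℂ)) N := by
  ext x
  have h1 := congrFun (map_sum (boundedMeasurable X).subtype (fun n =>
    ∏ s : Fin t, koopman T (((s : ℕ) + 1) * cantorSeq b D n) (g s)) (Finset.range N)) x
  rw [Finset.sum_apply] at h1
  change (N : ℂ)⁻¹ * _ = _
  rw [cantorAverage]
  congr 1
  refine h1.trans (Finset.sum_congr rfl fun n _ => ?_)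
  exact boundedMeasurable.prod_apply _ _ x

end Main

theorem mainTheorem5 {X : Type*} [MeasurableSpace X] (μ : Measure X) [IsProbabilityMeasure μ]
    (T : X ≃ᵐ X) (hT : IsWeaklyMixing μ T)
    (b : ℕ) (D : Finset ℕ) (hD : IsClassicalDigitSet b D) (h0 : 0 ∈ D)
    (t : ℕ) (f : Fin t → X → ℂ) (hf : ∀ s, MemLp (f s) ∞ μ) :
    Tendsto (fun N : ℕ => eLpNorm (fun x => cantorAverage b D T f N x - ∏ s, ∫ y, f s y ∂μ) 2 μ)
      atTop (𝓝 0) := by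
  choose g hg using fun s => exists_boundedMeasurable_ae_eq (hf s)
  have h1 := multipleConvergence hT hD h0 (fun s : Fin t => (s : ℕ) + 1)
    (fun i j hij => Nat.add_lt_add_right hij 1) (fun s => Nat.succ_pos _) g
  -- Exactly `N` elements of the Cantor set lie below `cantorSeq b D N`, so this cutoff recovers the
  -- average over the first `N` elements.
  have h2 := h1.comp (tendsto_cantorSeq hD h0)
  rw [tendsto_iff_edist_tendsto_0] at h2
  refine h2.congr fun N => ?_
  have hint : ∀ s, ∫ y, f s y ∂μ = boundedMeasurable.mean μ (g s) := fun s =>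
    integral_congr_ae (hg s)
  rw [Function.comp_apply, card_cantorInitial_cantorSeq hD h0, ← sum_range_cantorSeq hD h0
    (fun k => boundedMeasurable.toLp μ (∏ s : Fin t,
      boundedMeasurable.koopman T (((s : ℕ) + 1) * k) (g s))),
    ← map_sum, ← map_smul, ← map_smul, edist_eq_enorm_sub, ← map_sub,
    boundedMeasurable.enorm_toLp]
  refine eLpNorm_congr_ae ?_
  filter_upwards [cantorAverage_ae_eq (b := b) (D := D) hT.measurePreserving hg N] with x hx
  rw [hx, ← boundedMeasurable.cantorAverage_eq]
  simp only [hint]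
  change _ - (∏ s, boundedMeasurable.mean μ (g s)) * 1 = _
  rw [mul_one]
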